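/- **Theorem 3.3 (Uniform Operator Law of Large Numbers).** For every real $K$ there is a constant $C=C(K)>0$, depending only on $K$, such that the following holds. Let $n,r,k$ be integers with $r\ge 2$ and $1\le k\le n$, let $0<\varepsilon\le 1$, and let $x_1,\dots,x_n\in\mathbb{C}^n$ satisfy $\|x_i\|_\infty\le K$ for all $i$ and $$\mathrm{id}_{\mathbb{C}^n}=\frac1n\sum_{i=1}^n x_i\otimes x_i ,$$ where $v\otimes v$ denotes the rank-one operator $z\mapsto\langle v,z\rangle v$ and $\langle v,z\rangle=\sum_j\overline{v_j}z_j$. Let $\Omega$ be a uniformly distributed random $k$-element subset of $\{1,\dots,n\}$. If $$k\ \ge\ C\,\Big(\frac{r\log n}{\varepsilon^2}\Big)\,\log\Big(\frac{r\log n}{\varepsilon^2}\Big)\,\log^2 r ,$$ (the right-hand side being read as $0$ if $n=1$), then $$\mathbb{E}\ \sup_{T\subseteq\{1,\dots,n\},\ |T|\le r}\ \Big\|\mathrm{id}_{\mathbb{C}^T}-\frac1k\sum_{i\in\Omega}x_i^T\otimes x_i^T\Big\|\ \le\ \varepsilon .$$ Here $x^T\in\mathbb{C}^T$ is the restriction of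 $x$ to the coordinates in $T$, and $\|\cdot\|$ is the operator norm on $\ell_2^T$. -/

import Mathlib

open scoped BigOperators

/-- The restriction `x^T` of a vector `x ∈ ℂⁿ` to its coordinates in `T`, as a vector of the
Hilbert space `ℓ₂^T = ℂ^T`. -/
noncomputable def restrictCoords {n : ℕ} (T : Finset (Fin n)) (x : EuclideanSpace ℂ (Fin n)) :
    EuclideanSpace ℂ T :=
  WithLp.toLp 2 (fun t : T => x t)

/-- The rank-one operator `v ⊗ v : z ↦ ⟨v, z⟩ v` (inner product linear in `z`). -/
noncomputable def tensorSelf {ι : Type*} [Fintype ι] (v : EuclideanSpace ℂ ι) :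
    EuclideanSpace ℂ ι →L[ℂ] EuclideanSpace ℂ ι :=
  InnerProductSpace.rankOne ℂ v v

/-- `sup_{|T| ≤ r} ‖id_{ℂ^T} - (1/k) ∑_{i ∈ Ω} x_i^T ⊗ x_i^T‖`, with the operator norm on `ℓ₂^T`.
The supremum is over a finite nonempty family. -/
noncomputable def uniformDeviation {n : ℕ} (x : Fin n → EuclideanSpace ℂ (Fin n)) (r k : ℕ)
    (Ω : Finset (Fin n)) : ℝ :=
  ⨆ T : {T : Finset (Fin n) // T.card ≤ r},
    ‖ContinuousLinearMap.id ℂ (EuclideanSpace ℂ T.1) -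
      ((1 : ℂ) / (k : ℂ)) • ∑ i ∈ Ω, tensorSelf (restrictCoords T.1 (x i))‖

/-- The expectation of `f Ω` for `Ω` uniformly distributed over the `k`-element subsets of an
`n`-element set (used for `k ≤ n`). -/
noncomputable def expectRandomSubset (n k : ℕ) (f : Finset (Fin n) → ℝ) : ℝ :=
  𝔼 Ω ∈ Finset.powersetCard k (Finset.univ : Finset (Fin n)), f Ω

/-! By convexity a random `k`-set is dominated by `k` independent uniform indices, and
symmetrization replaces the centred sum by a Rademacher sum of the operators x_i^T ⊗ x_i^T, for all
T at once. These sums are self-adjoint, so their norm is the supremum over the r-sparse unit ball of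
the process z ↦ |∑ ±|⟨y_i, z⟩|²|, with the sampled vectors y_i held fixed.

The heart is a chaining bound for this process, `exists_net_rademacherBound`. If R² bounds ∑ |⟨y_i,
z⟩|² on the sparse ball, increments are subgaussian with parameter 2R max_i |⟨y_i, z - w⟩|. The
sparse ball lies in √r times the ℓ₁ ball, so Maurey's empirical method with 4^l samples cuts it into
at most (4n)^(4^l) cells on which every ⟨y_i, ·⟩ varies by at most U/2^l, where U is of order K √(r
log k). Every dyadic scale then costs the same R U √log(4n), up to a constant; after about log₂ r
scales a Euclidean 1/8-net takes over. The number of scales is the factor log r in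
`expect_norm_rademacher_coordTensor_le`.

That bound contains the square root of ‖∑ y_i^T ⊗ y_i^T‖, which is at most the deviation plus k. The
expected deviation is therefore bounded in terms of itself, and this closes as soon as k ≥ Q (r log
n / ε²) log² r log k. `mul_log_le_of_mul_log_le` trades this log k for the logarithm in the
hypothesis. -/

/-! ### Maxima of finite Rademacher families -/

/-- The sign encoded by a Boolean. -/
def boolSign (b : Bool) : ℝ := if b then 1 else -1

lemma expect_exp_rademacher_le {ι : Type*} [Fintype ι] [DecidableEq ι] (v : ι → ℝ) :
    𝔼 e : ι → Bool, Real.exp (∑ i, boolSign (e i) * v i) ≤ Real.exp ((∑ i, v i ^ 2) / 2) := by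
  have h1 : ∑ e : ι → Bool, Real.exp (∑ i, boolSign (e i) * v i)
      = ∏ i, ∑ b : Bool, Real.exp (boolSign b * v i) := by
    rw [Finset.prod_univ_sum]
    simp only [Fintype.piFinset_univ, Real.exp_sum]
  rw [Fintype.expect_eq_sum_div_card, h1]
  have h2 : (Fintype.card (ι → Bool) : ℝ) = ∏ _i : ι, (2 : ℝ) := by simp
  rw [h2, ← Finset.prod_div_distrib, Finset.sum_div, Real.exp_sum]
  refine Finset.prod_le_prod (fun i _ => by positivity) fun i _ => ?_
  have := Real.cosh_le_exp_half_sq (v i)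
  rw [Real.cosh_eq] at this
  simpa [boolSign] using this

/-- The tangent line to log at `A`, taken at e^x. Being affine in e^x it can be averaged, so it
plays the role of Jensen's inequality. -/
lemma le_log_add_exp_div_sub_one (x : ℝ) {A : ℝ} (hA : 0 < A) :
    x ≤ Real.log A + (Real.exp x / A - 1) := by
  have := Real.log_le_sub_one_of_pos (show 0 < Real.exp x / A by positivity)
  rw [Real.log_div (by positivity) hA.ne', Real.log_exp] at this
  linarith

/-- The Rademacher process indexed by the set `F` is dominated by a random variable whose mean is
at most `B`. -/
def RademacherBound {ι : Type*} [Fintype ι] [DecidableEq ι] (F : Set (ι → ℝ)) (B : ℝ) : Prop :=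
  ∃ Y : (ι → Bool) → ℝ, (∀ e, ∀ v ∈ F, |∑ i, boolSign (e i) * v i| ≤ Y e) ∧ 𝔼 e, Y e ≤ B

section
variable {ι : Type*} [Fintype ι] [DecidableEq ι]

lemma RademacherBound.mono {F G : Set (ι → ℝ)} {A B : ℝ} (h : RademacherBound F A) (hFG : G ⊆ F)
    (hAB : A ≤ B) : RademacherBound G B := by
  obtain ⟨Y, h1, h2⟩ := h
  exact ⟨Y, fun e v hv => h1 e v (hFG hv), h2.trans hAB⟩

lemma RademacherBound.add {F G H : Set (ι → ℝ)} {A B : ℝ} (hF : RademacherBound F A)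
    (hG : RademacherBound G B) (h : ∀ v ∈ H, ∃ u ∈ F, ∃ w ∈ G, v = u + w) :
    RademacherBound H (A + B) := by
  obtain ⟨Y, h1, h2⟩ := hF
  obtain ⟨Z, h3, h4⟩ := hG
  refine ⟨fun e => Y e + Z e, fun e v hv => ?_, ?_⟩
  · obtain ⟨u, hu, w, hw, rfl⟩ := h v hv
    have : ∑ i, boolSign (e i) * (u + w) i
        = ∑ i, boolSign (e i) * u i + ∑ i, boolSign (e i) * w i := by
      rw [← Finset.sum_add_distrib]
      exact Finset.sum_congr rfl fun i _ => by simp [mul_add]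
    rw [this]
    exact (abs_add_le _ _).trans (add_le_add (h1 e u hu) (h3 e w hw))
  · rw [Finset.expect_add_distrib]
    exact add_le_add h2 h4

lemma RademacherBound.sum_range {X : Type*} (F : ℕ → X → ι → ℝ) (A : ℝ) (L : ℕ)
    (h : ∀ l < L, RademacherBound (Set.range (F l)) A) :
    RademacherBound (Set.range fun x => ∑ l ∈ Finset.range L, F l x) (L * A) := by
  induction L with
  | zero =>
    refine ⟨fun _ => 0, ?_, by simp⟩
    rintro e v ⟨x, rfl⟩
    simp
  | succ L ih =>
    have := (ih fun l hl => h l (by omega)).add (h L (by omega))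
      (H := Set.range fun x => ∑ l ∈ Finset.range (L + 1), F l x) ?_
    · convert this using 1
      push_cast; ring
    · rintro v ⟨x, rfl⟩
      exact ⟨_, ⟨x, rfl⟩, _, ⟨x, rfl⟩, Finset.sum_range_succ _ _⟩

lemma rademacherBound_range {S : Type*} [Fintype S] [Nonempty S] (b : S → ι → ℝ) {σ N : ℝ}
    (hσ' : 0 ≤ σ) (hb : ∀ s, ∑ i, b s i ^ 2 ≤ σ ^ 2) (hN : (Fintype.card S : ℝ) ≤ N) :
    RademacherBound (Set.range b) (σ * √(2 * Real.log (2 * N))) := by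
  have hS : (1 : ℝ) ≤ Fintype.card S := by exact_mod_cast Fintype.card_pos
  rcases hσ'.eq_or_lt with rfl | hσ
  · refine ⟨fun _ => 0, ?_, by simp⟩
    rintro e v ⟨s, rfl⟩
    have h0 : ∑ i, b s i ^ 2 = 0 :=
      le_antisymm (by simpa using hb s) (Finset.sum_nonneg fun i _ => sq_nonneg _)
    rw [Finset.sum_eq_zero_iff_of_nonneg fun i _ => sq_nonneg _] at h0
    have h1 : ∀ i, b s i = 0 := fun i => by simpa using h0 i (Finset.mem_univ i)
    simp [h1]
  have hlog : 0 < Real.log (2 * N) := Real.log_pos (by linarith)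
  set M := √(2 * Real.log (2 * N)) with hM
  have hM0 : 0 < M := Real.sqrt_pos.2 (by positivity)
  have hMsq : M ^ 2 = 2 * Real.log (2 * N) := Real.sq_sqrt (by positivity)
  -- With this `t`, log `A` = log(2N) + M²/2 = M², so the final bound M²/t is exactly σM.
  set t := M / σ with ht
  have ht0 : 0 < t := by positivity
  set A := 2 * N * Real.exp (M ^ 2 / 2) with hA
  have hA0 : 0 < A := by have : 0 < N := by linarith
                         positivity
  let W : (ι → Bool) → ℝ := fun e => ∑ s, (Real.exp (∑ i, boolSign (e i) * (t * b s i))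
    + Real.exp (∑ i, boolSign (e i) * (-t * b s i)))
  have hW : 𝔼 e, W e ≤ A := by
    simp only [W]
    rw [Finset.expect_sum_comm]
    calc _ ≤ ∑ s : S, 2 * Real.exp (M ^ 2 / 2) := by
          refine Finset.sum_le_sum fun s _ => ?_
          rw [Finset.expect_add_distrib, two_mul]
          have key : ∀ u : ℝ, u ^ 2 = t ^ 2 → (∑ i, (u * b s i) ^ 2) / 2 ≤ M ^ 2 / 2 := by
            intro u hu
            have : ∑ i, (u * b s i) ^ 2 = t ^ 2 * ∑ i, b s i ^ 2 := by
              rw [Finset.mul_sum]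
              exact Finset.sum_congr rfl fun i _ => by rw [mul_pow, hu]
            rw [this]
            have h3 : t ^ 2 * ∑ i, b s i ^ 2 ≤ t ^ 2 * σ ^ 2 := by gcongr; exact hb s
            have h4 : t ^ 2 * σ ^ 2 = M ^ 2 := by rw [ht]; field_simp
            linarith
          exact add_le_add
            ((expect_exp_rademacher_le _).trans (Real.exp_le_exp.2 (key t rfl)))
            ((expect_exp_rademacher_le _).trans (Real.exp_le_exp.2 (key (-t) (by ring))))
      _ = Fintype.card S * (2 * Real.exp (M ^ 2 / 2)) := by simp
      _ ≤ A := by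
          rw [hA]
          nlinarith [Real.exp_pos (M ^ 2 / 2)]
  refine ⟨fun e => (Real.log A + (W e / A - 1)) / t, ?_, ?_⟩
  · rintro e v ⟨s, rfl⟩
    rw [le_div_iff₀ ht0]
    have hs : Real.exp (∑ i, boolSign (e i) * (t * b s i))
      + Real.exp (∑ i, boolSign (e i) * (-t * b s i)) ≤ W e :=
      Finset.single_le_sum (f := fun s => Real.exp (∑ i, boolSign (e i) * (t * b s i))
        + Real.exp (∑ i, boolSign (e i) * (-t * b s i))) (fun s _ => by positivity)
        (Finset.mem_univ s)
    have e1 : ∀ u : ℝ, ∑ i, boolSign (e i) * (u * b s i) = (∑ i, boolSign (e i) * b s i) * u := by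
      intro u
      rw [Finset.sum_mul]
      exact Finset.sum_congr rfl fun i _ => by ring
    rw [e1, e1] at hs
    have h5 : Real.exp (|∑ i, boolSign (e i) * b s i| * t) ≤ W e := by
      rcases abs_cases (∑ i, boolSign (e i) * b s i) with h | h
      · rw [h.1]; linarith [Real.exp_pos ((∑ i, boolSign (e i) * b s i) * -t)]
      · rw [h.1]
        have : -(∑ i, boolSign (e i) * b s i) * t = (∑ i, boolSign (e i) * b s i) * -t := by ring
        rw [this]; linarith [Real.exp_pos ((∑ i, boolSign (e i) * b s i) * t)]
    refine (le_log_add_exp_div_sub_one _ hA0).trans ?_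
    gcongr
  · have : 𝔼 e : ι → Bool, (Real.log A + (W e / A - 1)) / t
        = (Real.log A + ((𝔼 e, W e) / A - 1)) / t := by
      rw [← Finset.expect_div, Finset.expect_add_distrib, Finset.expect_sub_distrib,
        ← Finset.expect_div]
      simp
    rw [this]
    have h6 : (𝔼 e, W e) / A ≤ 1 := (div_le_one hA0).2 hW
    have h7 : Real.log A = M ^ 2 := by
      rw [hA, Real.log_mul (by linarith) (by positivity), Real.log_exp]
      linarith
    calc _ ≤ M ^ 2 / t := by gcongr; linarith
      _ = σ * M := by rw [ht]; field_simp

/-- An infinite family that depends only on a finite key costs no more than its number of keys; one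
representative per key is enough. -/
lemma rademacherBound_range_of_key {X S : Type*} [Nonempty X] [Fintype S] (key : X → S)
    (v : X → ι → ℝ) (hv : ∀ x x', key x = key x' → v x = v x') {σ N : ℝ} (hσ : 0 ≤ σ)
    (hb : ∀ x, ∑ i, v x i ^ 2 ≤ σ ^ 2) (hN : (Fintype.card S : ℝ) ≤ N) :
    RademacherBound (Set.range v) (σ * √(2 * Real.log (2 * N))) := by
  have : Nonempty S := ⟨key (Classical.arbitrary X)⟩
  refine (rademacherBound_range (fun s => v (Function.invFun key s)) hσ (fun s => hb _) hN).mono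
    ?_ le_rfl
  rintro _ ⟨x, rfl⟩
  exact ⟨key x, hv _ _ (Function.invFun_eq ⟨x, rfl⟩)⟩

end

/-! ### Sampling without and with replacement -/

section
variable {α : Type*} [Fintype α] [DecidableEq α]

/-- The average over all permutations of the image of a `k`-set is the average over `k`-sets. -/
lemma expect_perm_map_eq_expect_powersetCard {k : ℕ} (G : Finset α → ℝ) (Ω₀ : Finset α)
    (hΩ₀ : Ω₀.card = k) :
    𝔼 σ : Equiv.Perm α, G (Ω₀.map σ.toEmbedding) =
      𝔼 Ω ∈ Finset.powersetCard k Finset.univ, G Ω := by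
  have h1 : ∀ Ω ∈ Finset.powersetCard k (Finset.univ : Finset α),
      𝔼 σ : Equiv.Perm α, G (Ω.map σ.toEmbedding) =
        𝔼 σ : Equiv.Perm α, G (Ω₀.map σ.toEmbedding) := by
    intro Ω hΩ
    rw [Finset.mem_powersetCard_univ] at hΩ
    let e : {x // x ∈ Ω} ≃ {x // x ∈ Ω₀} := Finset.equivOfCardEq (hΩ.trans hΩ₀.symm)
    let τ : Equiv.Perm α := e.extendSubtype
    have hτ : Ω.map τ.toEmbedding = Ω₀ := by
      apply Finset.eq_of_subset_of_card_le
      · intro y hy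
        obtain ⟨x, hx, rfl⟩ := Finset.mem_map.1 hy
        exact e.extendSubtype_mem x hx
      · rw [Finset.card_map, hΩ, hΩ₀]
    symm
    refine Fintype.expect_equiv (Equiv.mulRight τ) _ _ fun σ => ?_
    rw [← hτ, Finset.map_map]
    rfl
  have h2 : ∀ σ : Equiv.Perm α,
      𝔼 Ω ∈ Finset.powersetCard k (Finset.univ : Finset α), G (Ω.map σ.toEmbedding) =
        𝔼 Ω ∈ Finset.powersetCard k (Finset.univ : Finset α), G Ω := by
    intro σ
    refine Finset.expect_equiv σ.finsetCongr (fun Ω => ?_) (fun Ω _ => rfl)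
    simp
  have hne : (Finset.powersetCard k (Finset.univ : Finset α)).Nonempty :=
    ⟨Ω₀, Finset.mem_powersetCard_univ.2 hΩ₀⟩
  calc 𝔼 σ : Equiv.Perm α, G (Ω₀.map σ.toEmbedding)
      = 𝔼 Ω ∈ Finset.powersetCard k (Finset.univ : Finset α),
          𝔼 σ : Equiv.Perm α, G (Ω.map σ.toEmbedding) := by
        rw [Finset.expect_congr rfl h1, Finset.expect_const hne]
    _ = 𝔼 σ : Equiv.Perm α,
          𝔼 Ω ∈ Finset.powersetCard k (Finset.univ : Finset α), G (Ω.map σ.toEmbedding) :=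
        Finset.expect_comm _ _ _
    _ = _ := by rw [Finset.expect_congr rfl fun σ _ => h2 σ, Fintype.expect_const]

lemma norm_sum_div_card_le_expect {E β : Type*} [SeminormedAddCommGroup E] [Fintype β]
    (f : β → E) :
    (Fintype.card β : ℝ)⁻¹ * ‖∑ b, f b‖ ≤ 𝔼 b, ‖f b‖ := by
  rw [Fintype.expect_eq_sum_div_card, inv_mul_eq_div]
  gcongr
  exact norm_sum_le _ _

variable {E : Type*} [NormedAddCommGroup E] [NormedSpace ℝ E]

/-- Enumerate `Ω₀` by `Fin k` and shift cyclically. Averaged over the `k` shifts, each of the `k`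
draws becomes the mean of `a` over the set, so the draws together give the full sum. A shift is a
permutation of `Ω₀`, hence invisible after averaging over `σ`, and convexity of the norm concludes.
-/
lemma norm_sum_le_expect_perm {k : ℕ} [NeZero k] (a : α → E) (Ω₀ : Finset α)
    (hΩ₀ : Ω₀.card = k) (g : Fin k → α) (hg : ∀ i, g i ∈ Ω₀) :
    𝔼 σ : Equiv.Perm α, ‖∑ j ∈ Ω₀.map σ.toEmbedding, a j‖ ≤
      𝔼 σ : Equiv.Perm α, ‖∑ i, a (σ (g i))‖ := by
  let e : Fin k ≃ Ω₀ := (Fintype.equivFinOfCardEq (by simpa using hΩ₀)).symm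
  let e' : Fin k ↪ α := e.toEmbedding.trans (Function.Embedding.subtype _)
  let w : Fin k → Fin k := fun i => e.symm ⟨g i, hg i⟩
  have hw : ∀ i, e' (w i) = g i := fun i => by simp [e', w]
  have h1 : ∀ s : Fin k, 𝔼 σ : Equiv.Perm α, ‖∑ i, a (σ (e' (w i + s)))‖ =
      𝔼 σ : Equiv.Perm α, ‖∑ i, a (σ (g i))‖ := by
    intro s
    refine Fintype.expect_equiv
      (Equiv.mulRight (Equiv.Perm.viaEmbedding (Equiv.addRight s) e')) _ _ fun σ => ?_
    simp only [Equiv.coe_mulRight, Equiv.Perm.mul_apply, ← hw, Equiv.Perm.viaEmbedding_apply,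
      Equiv.coe_addRight]
  have hk : (0 : ℝ) < k := by exact_mod_cast NeZero.pos k
  have h2 : ∀ σ : Equiv.Perm α, ‖∑ j ∈ Ω₀.map σ.toEmbedding, a j‖ ≤
      𝔼 s : Fin k, ‖∑ i, a (σ (e' (w i + s)))‖ := by
    intro σ
    have h3 : ∑ s : Fin k, ∑ i, a (σ (e' (w i + s))) =
        (k : ℝ) • ∑ j ∈ Ω₀.map σ.toEmbedding, a j := by
      rw [Finset.sum_comm]
      have : ∀ i, ∑ s : Fin k, a (σ (e' (w i + s))) = ∑ j ∈ Ω₀.map σ.toEmbedding, a j := by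
        intro i
        rw [Fintype.sum_equiv (Equiv.addLeft (w i)) (fun s => a (σ (e' (w i + s))))
            (fun s => a (σ (e' s))) (fun s => rfl), Finset.sum_map, Fintype.sum_equiv e (fun s => a (σ (e' s)))
            (fun s : Ω₀ => a (σ s)) (fun s => rfl)]
        exact Finset.sum_coe_sort Ω₀ (fun j => a (σ j))
      rw [Finset.sum_congr rfl fun i _ => this i]
      simp [Nat.cast_smul_eq_nsmul]
    have := norm_sum_div_card_le_expect (fun s : Fin k => ∑ i, a (σ (e' (w i + s))))
    rw [h3, norm_smul, Fintype.card_fin, Real.norm_natCast, inv_mul_cancel_left₀ hk.ne'] at this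
    exact this
  calc _ ≤ 𝔼 σ : Equiv.Perm α, 𝔼 s : Fin k, ‖∑ i, a (σ (e' (w i + s)))‖ :=
        Finset.expect_le_expect fun σ _ => h2 σ
    _ = 𝔼 s : Fin k, 𝔼 σ : Equiv.Perm α, ‖∑ i, a (σ (e' (w i + s)))‖ := Finset.expect_comm _ _ _
    _ = _ := by rw [Finset.expect_congr rfl fun s _ => h1 s, Fintype.expect_const]

/-- Hoeffding's comparison of sampling without and with replacement. -/
lemma expect_powersetCard_norm_sum_le {k : ℕ} [NeZero k] (hk : k ≤ Fintype.card α) (a : α → E) :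
    𝔼 Ω ∈ Finset.powersetCard k (Finset.univ : Finset α), ‖∑ j ∈ Ω, a j‖ ≤
      𝔼 g : Fin k → α, ‖∑ i, a (g i)‖ := by
  have h1 : ∀ g : Fin k → α, 𝔼 Ω ∈ Finset.powersetCard k (Finset.univ : Finset α),
      ‖∑ j ∈ Ω, a j‖ ≤ 𝔼 σ : Equiv.Perm α, ‖∑ i, a (σ (g i))‖ := by
    intro g
    -- The draws take at most `k` values, so some `k`-set contains them all, repetitions included.
    obtain ⟨Ω₀, h1, -, h2⟩ := Finset.exists_subsuperset_card_eq
      (Finset.subset_univ (Finset.univ.image g)) (n := k)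
      (Finset.card_image_le.trans (by simp)) (by simpa using hk)
    rw [← expect_perm_map_eq_expect_powersetCard (fun Ω => ‖∑ j ∈ Ω, a j‖) Ω₀ h2]
    exact norm_sum_le_expect_perm a Ω₀ h2 g fun i => h1 (Finset.mem_image_of_mem _ (Finset.mem_univ i))
  have h2 : ∀ σ : Equiv.Perm α, 𝔼 g : Fin k → α, ‖∑ i, a (σ (g i))‖ =
      𝔼 g : Fin k → α, ‖∑ i, a (g i)‖ := fun σ =>
    Fintype.expect_equiv (Equiv.arrowCongr (Equiv.refl _) σ) _ _ fun g => by simp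
  have : Nonempty α := Fintype.card_pos_iff.1 ((NeZero.pos k).trans_le hk)
  calc _ = 𝔼 _g : Fin k → α, 𝔼 Ω ∈ Finset.powersetCard k (Finset.univ : Finset α),
        ‖∑ j ∈ Ω, a j‖ := (Fintype.expect_const _).symm
    _ ≤ 𝔼 g : Fin k → α, 𝔼 σ : Equiv.Perm α, ‖∑ i, a (σ (g i))‖ :=
        Finset.expect_le_expect fun g _ => h1 g
    _ = 𝔼 σ : Equiv.Perm α, 𝔼 g : Fin k → α, ‖∑ i, a (σ (g i))‖ := Finset.expect_comm _ _ _
    _ = _ := by rw [Finset.expect_congr rfl fun s _ => h2 s, Fintype.expect_const]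

end

/-! ### Symmetrization -/

lemma expect_prod_type {β γ : Type*} [Fintype β] [Fintype γ] (F : β → γ → ℝ) :
    𝔼 p : β × γ, F p.1 p.2 = 𝔼 b, 𝔼 c, F b c := by
  rw [← Finset.expect_product', Finset.univ_product_univ]

/-- Symmetrization for independent uniform samples. -/
lemma expect_norm_sum_sub_mean_le {α : Type*} [Fintype α] [Nonempty α]
    {E : Type*} [NormedAddCommGroup E] [NormedSpace ℝ E]
    {ι : Type*} [Fintype ι] [DecidableEq ι]
    (f : α → E) (μ : E) (hμ : (Fintype.card α : ℝ) • μ = ∑ j, f j) :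
    𝔼 g : ι → α, ‖∑ i, (f (g i) - μ)‖ ≤
      2 * 𝔼 g : ι → α, 𝔼 e : ι → Bool, ‖∑ i, boolSign (e i) • f (g i)‖ := by
  classical
  have hmean : ∀ i, ∑ g : ι → α, f (g i) = (Fintype.card (ι → α) : ℝ) • μ := by
    intro i
    have h := Fintype.sum_piFinset_apply f (Finset.univ : Finset α) i
    have : Nonempty ι := ⟨i⟩
    have hc : Fintype.card (ι → α) = Fintype.card α ^ (Fintype.card ι - 1) * Fintype.card α := by
      rw [← pow_succ, Nat.sub_add_cancel Fintype.card_pos]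
      simp
    rw [Fintype.piFinset_univ] at h
    rw [h, ← hμ, hc, Finset.card_univ, Nat.cast_mul, mul_smul]
    simp only [Nat.cast_smul_eq_nsmul]
  have hN : (0 : ℝ) < Fintype.card (ι → α) := by exact_mod_cast Fintype.card_pos
  have h1 : ∀ g : ι → α, ‖∑ i, (f (g i) - μ)‖ ≤
      𝔼 g' : ι → α, ‖∑ i, (f (g i) - f (g' i))‖ := by
    intro g
    have h2 : ∑ g' : ι → α, ∑ i, (f (g i) - f (g' i)) =
        (Fintype.card (ι → α) : ℝ) • ∑ i, (f (g i) - μ) := by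
      rw [Finset.sum_comm, Finset.smul_sum]
      refine Finset.sum_congr rfl fun i _ => ?_
      rw [Finset.sum_sub_distrib, hmean, smul_sub, Finset.sum_const, Finset.card_univ]
      simp only [Nat.cast_smul_eq_nsmul]
    have := norm_sum_div_card_le_expect (fun g' : ι → α => ∑ i, (f (g i) - f (g' i)))
    rwa [h2, norm_smul, Real.norm_natCast, inv_mul_cancel_left₀ hN.ne'] at this
  have hswap : ∀ e : ι → Bool,
      𝔼 p : (ι → α) × (ι → α), ‖∑ i, (f (p.1 i) - f (p.2 i))‖ =
        𝔼 p : (ι → α) × (ι → α), ‖∑ i, boolSign (e i) • (f (p.1 i) - f (p.2 i))‖ := by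
    intro e
    -- Exchanging the two copies at the indices of sign -1 preserves the uniform law and flips
    -- exactly those differences.
    let s : (ι → α) × (ι → α) → (ι → α) × (ι → α) := fun p =>
      (fun i => if e i then p.1 i else p.2 i, fun i => if e i then p.2 i else p.1 i)
    have hs : Function.Involutive s := by
      intro p
      ext i <;> by_cases h : e i <;> simp [s, h]
    refine Fintype.expect_equiv hs.toPerm _ _ fun p => ?_
    congr 1
    refine Finset.sum_congr rfl fun i _ => ?_
    by_cases h : e i <;> simp [s, h, boolSign]
  have hsplit : ∀ e : ι → Bool,
      𝔼 p : (ι → α) × (ι → α), ‖∑ i, boolSign (e i) • (f (p.1 i) - f (p.2 i))‖ ≤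
        2 * 𝔼 g : ι → α, ‖∑ i, boolSign (e i) • f (g i)‖ := by
    intro e
    calc _ ≤ 𝔼 p : (ι → α) × (ι → α), (‖∑ i, boolSign (e i) • f (p.1 i)‖ +
          ‖∑ i, boolSign (e i) • f (p.2 i)‖) := by
          refine Finset.expect_le_expect fun p _ => ?_
          simp only [smul_sub, Finset.sum_sub_distrib]
          exact norm_sub_le _ _
      _ = _ := by
          rw [expect_prod_type fun g g' : ι → α => ‖∑ i, boolSign (e i) • f (g i)‖ +
              ‖∑ i, boolSign (e i) • f (g' i)‖]
          simp only [Finset.expect_add_distrib, Fintype.expect_const]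
          ring
  calc _ ≤ 𝔼 g : ι → α, 𝔼 g' : ι → α, ‖∑ i, (f (g i) - f (g' i))‖ :=
        Finset.expect_le_expect fun g _ => h1 g
    _ = 𝔼 p : (ι → α) × (ι → α), ‖∑ i, (f (p.1 i) - f (p.2 i))‖ := by
        rw [expect_prod_type fun g g' : ι → α => ‖∑ i, (f (g i) - f (g' i))‖]
    _ = 𝔼 e : ι → Bool, 𝔼 p : (ι → α) × (ι → α), ‖∑ i, (f (p.1 i) - f (p.2 i))‖ :=
        (Fintype.expect_const _).symm
    _ ≤ 𝔼 e : ι → Bool, 2 * 𝔼 g : ι → α, ‖∑ i, boolSign (e i) • f (g i)‖ :=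
        Finset.expect_le_expect fun e _ => (hswap e).trans_le (hsplit e)
    _ = _ := by rw [← Finset.mul_expect, Finset.expect_comm]

/-! ### Maurey's empirical method -/

/-- Hoeffding's lemma for a finite probability distribution. -/
lemma sum_mul_exp_le_of_abs_le {V : Type*} [Fintype V] (p X : V → ℝ) {B : ℝ} (hB : 0 < B)
    (hp : ∀ v, 0 ≤ p v) (hp1 : ∑ v, p v = 1) (hX : ∀ v, |X v| ≤ B) (hX0 : ∑ v, p v * X v = 0)
    (t : ℝ) : ∑ v, p v * Real.exp (t * X v) ≤ Real.exp ((t * B) ^ 2 / 2) := by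
  refine le_trans ?_ (Real.cosh_le_exp_half_sq (t * B))
  have h : ∀ v, Real.exp (t * X v) ≤ Real.cosh (t * B) + X v * (Real.sinh (t * B) / B) := by
    intro v
    have hv := abs_le.1 (hX v)
    have ha : 0 ≤ (1 + X v / B) / 2 := by
      have : -1 ≤ X v / B := by rw [le_div_iff₀ hB]; linarith
      linarith
    have hb : 0 ≤ (1 - X v / B) / 2 := by
      have : X v / B ≤ 1 := by rw [div_le_iff₀ hB]; linarith
      linarith
    have := convexOn_exp.2 (Set.mem_univ (t * B)) (Set.mem_univ (-(t * B))) ha hb (by ring)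
    simp only [smul_eq_mul] at this
    rw [Real.cosh_eq, Real.sinh_eq]
    calc _ = Real.exp ((1 + X v / B) / 2 * (t * B) + (1 - X v / B) / 2 * -(t * B)) := by
          congr 1; field_simp; ring
      _ ≤ _ := this
      _ = _ := by ring
  calc _ ≤ ∑ v, p v * (Real.cosh (t * B) + X v * (Real.sinh (t * B) / B)) :=
        Finset.sum_le_sum fun v _ => mul_le_mul_of_nonneg_left (h v) (hp v)
    _ = (∑ v, p v) * Real.cosh (t * B) + (∑ v, p v * X v) * (Real.sinh (t * B) / B) := by
        rw [Finset.sum_mul, Finset.sum_mul, ← Finset.sum_add_distrib]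
        exact Finset.sum_congr rfl fun v _ => by ring
    _ = _ := by rw [hp1, hX0]; ring

/-- Greedy choice keeping an exponential potential small. -/
lemma exists_sum_exp_sum_le {V I : Type*} [Fintype V] [Fintype I] (p : V → ℝ) (X : V → I → ℝ)
    {B : ℝ} (hB : 0 < B) (hp : ∀ v, 0 ≤ p v) (hp1 : ∑ v, p v = 1) (hX : ∀ v i, |X v i| ≤ B)
    (hX0 : ∀ i, ∑ v, p v * X v i = 0) (t : ℝ) (m : ℕ) :
    ∃ w : Fin m → V, ∑ i, Real.exp (t * ∑ j, X (w j) i) ≤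
      Fintype.card I * Real.exp (m * ((t * B) ^ 2 / 2)) := by
  induction m with
  | zero => exact ⟨Fin.elim0, by simp⟩
  | succ m ih =>
    obtain ⟨w, hw⟩ := ih
    -- The potential after appending `v`. By Hoeffding its `p`-average grows by at most the factor
    -- exp((tB)²/2), so some `v` does no worse than the average.
    let Φ : V → ℝ := fun v => ∑ i, Real.exp (t * ∑ j, X (w j) i) * Real.exp (t * X v i)
    have h1 : ∑ v, p v * Φ v ≤
        ∑ v, p v * (Fintype.card I * Real.exp ((m + 1 : ℕ) * ((t * B) ^ 2 / 2))) := by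
      calc _ = ∑ i, Real.exp (t * ∑ j, X (w j) i) * ∑ v, p v * Real.exp (t * X v i) := by
            simp only [Φ, Finset.mul_sum]
            rw [Finset.sum_comm]
            exact Finset.sum_congr rfl fun i _ => Finset.sum_congr rfl fun v _ => by ring
        _ ≤ ∑ i, Real.exp (t * ∑ j, X (w j) i) * Real.exp ((t * B) ^ 2 / 2) :=
            Finset.sum_le_sum fun i _ => mul_le_mul_of_nonneg_left
              (sum_mul_exp_le_of_abs_le p _ hB hp hp1 (fun v => hX v i) (hX0 i) t)
              (Real.exp_pos _).le
        _ ≤ (Fintype.card I * Real.exp (m * ((t * B) ^ 2 / 2))) * Real.exp ((t * B) ^ 2 / 2) := by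
            rw [← Finset.sum_mul]
            gcongr
        _ = _ := by
            rw [← Finset.sum_mul, hp1, one_mul, mul_assoc, ← Real.exp_add]
            congr 2; push_cast; ring
    obtain ⟨v, hv⟩ : ∃ v, Φ v ≤ Fintype.card I * Real.exp ((m + 1 : ℕ) * ((t * B) ^ 2 / 2)) := by
      by_contra! hcon
      obtain ⟨v, -, hv⟩ : ∃ v ∈ Finset.univ, p v ≠ 0 := by
        apply Finset.exists_ne_zero_of_sum_ne_zero
        rw [hp1]; norm_num
      refine absurd h1 (not_le.2 (Finset.sum_lt_sum
        (fun u _ => mul_le_mul_of_nonneg_left (hcon u).le (hp u)) ⟨v, Finset.mem_univ v, ?_⟩))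
      exact mul_lt_mul_of_pos_left (hcon v) (lt_of_le_of_ne (hp v) (Ne.symm hv))
    refine ⟨Fin.cons v w, le_trans (le_of_eq ?_) hv⟩
    refine Finset.sum_congr rfl fun i _ => ?_
    rw [← Real.exp_add, Fin.sum_univ_succ]
    simp only [Fin.cons_zero, Fin.cons_succ]
    congr 1; ring

/-- Maurey's empirical approximation of a convex combination. -/
lemma exists_empirical_mean_close {V I : Type*} [Fintype V] [Fintype I] [Nonempty I] (p : V → ℝ)
    (a : V → I → ℝ) {B : ℝ} (hB : 0 < B) (hp : ∀ v, 0 ≤ p v) (hp1 : ∑ v, p v = 1)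
    (ha : ∀ v i, |a v i| ≤ B) {m : ℕ} (hm : 0 < m) :
    ∃ w : Fin m → V, ∀ i, |∑ v, p v * a v i - (m : ℝ)⁻¹ * ∑ j, a (w j) i| ≤
      2 * B * √(2 * Real.log (2 * Fintype.card I) / m) := by
  have hI : (1 : ℝ) ≤ Fintype.card I := by exact_mod_cast Fintype.card_pos
  have hm' : (0 : ℝ) < m := by exact_mod_cast hm
  set l := Real.log (2 * Fintype.card I) with hl
  have hl0 : 0 < l := Real.log_pos (by linarith)
  set r := √(2 * l / m) with hr
  have hr0 : 0 < r := Real.sqrt_pos.2 (by positivity)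
  have hr2 : r ^ 2 = 2 * l / m := Real.sq_sqrt (by positivity)
  -- The optimal parameter: it equates `l` with m(2tB)²/2.
  set t := r / (2 * B) with ht
  have ht0 : 0 < t := by positivity
  let μ : I → ℝ := fun i => ∑ v, p v * a v i
  have hμ : ∀ i, |μ i| ≤ B := fun i => by
    calc |μ i| ≤ ∑ v, |p v * a v i| := Finset.abs_sum_le_sum_abs _ _
      _ ≤ ∑ v, p v * B := Finset.sum_le_sum fun v _ => by
          rw [abs_mul, abs_of_nonneg (hp v)]
          exact mul_le_mul_of_nonneg_left (ha v i) (hp v)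
      _ = B := by rw [← Finset.sum_mul, hp1, one_mul]
  let s : Bool → ℝ := boolSign
  have hs : ∀ b x, |s b * x| = |x| := by
    intro b x; cases b <;> simp [s, boolSign]
  -- Doubling the index set by a sign controls both tails; centring doubles the bound `B`.
  obtain ⟨w, hw⟩ := exists_sum_exp_sum_le p (fun v (q : I × Bool) => s q.2 * (a v q.1 - μ q.1))
    (B := 2 * B) (by positivity) hp hp1
    (fun v q => by
      rw [hs]
      have h1 := abs_le.1 (ha v q.1)
      have h2 := abs_le.1 (hμ q.1)
      exact abs_le.2 ⟨by linarith, by linarith⟩)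
    (fun q => by
      have : ∑ v, p v * (s q.2 * (a v q.1 - μ q.1)) =
          s q.2 * (∑ v, p v * a v q.1 - (∑ v, p v) * μ q.1) := by
        rw [Finset.sum_mul, ← Finset.sum_sub_distrib, Finset.mul_sum]
        exact Finset.sum_congr rfl fun v _ => by ring
      rw [this, hp1, one_mul, sub_self, mul_zero]) t m
  refine ⟨w, fun i => ?_⟩
  have hexp : ∀ b, t * ∑ j, s b * (a (w j) i - μ i) ≤ l + m * ((t * (2 * B)) ^ 2 / 2) := by
    intro b
    have h1 := (Finset.single_le_sum (f := fun q : I × Bool =>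
      Real.exp (t * ∑ j, s q.2 * (a (w j) q.1 - μ q.1))) (fun q _ => (Real.exp_pos _).le)
      (Finset.mem_univ (i, b))).trans hw
    rw [← Real.exp_le_exp]
    refine h1.trans (le_of_eq ?_)
    rw [Real.exp_add, hl, Real.exp_log (by linarith)]
    simp only [Fintype.card_prod, Fintype.card_bool, Nat.cast_mul, Nat.cast_ofNat]
    ring
  have hval : l + m * ((t * (2 * B)) ^ 2 / 2) = t * (m * (2 * B * r)) := by
    have : t * (2 * B) = r := by rw [ht]; field_simp
    have h2 : t * (m * (2 * B * r)) = m * (r ^ 2) := by rw [← this]; ring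
    rw [h2, this, hr2]
    field_simp
    ring
  rw [hval] at hexp
  have h3 : ∀ b, s b * ((m : ℝ)⁻¹ * ∑ j, a (w j) i - μ i) ≤ 2 * B * r := by
    intro b
    have h4 := le_of_mul_le_mul_left (hexp b) ht0
    rw [← Finset.mul_sum, Finset.sum_sub_distrib, Finset.sum_const, Finset.card_univ,
      Fintype.card_fin, nsmul_eq_mul] at h4
    refine le_of_mul_le_mul_left (le_trans (le_of_eq ?_) h4) hm'
    field_simp
  have h5 := h3 true
  have h6 := h3 false
  simp only [s, boolSign, if_true, Bool.false_eq_true, if_false] at h5 h6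
  rw [abs_le]
  constructor <;> simp only [μ] at h5 h6 <;> linarith

/-- Maurey's empirical approximation of an absolutely convex combination. -/
lemma exists_signed_empirical_mean_close {V I : Type*} [Fintype V] [Nonempty V] [Fintype I]
    [Nonempty I] (c : V → ℝ) (a : V → I → ℝ) {B : ℝ} (hB : 0 < B) (hc : ∑ v, |c v| ≤ 1)
    (ha : ∀ v i, |a v i| ≤ B) {m : ℕ} (hm : 0 < m) :
    ∃ w : Fin m → V × Bool, ∀ i,
      |∑ v, c v * a v i - (m : ℝ)⁻¹ * ∑ j, boolSign (w j).2 * a (w j).1 i| ≤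
        2 * B * √(2 * Real.log (2 * Fintype.card I) / m) := by
  have hV : (0 : ℝ) < Fintype.card V := by exact_mod_cast Fintype.card_pos
  -- The missing mass is spread equally over v and -v, so the weights sum to 1 and the mean is
  -- unchanged.
  let δ : ℝ := (1 - ∑ v, |c v|) / (2 * Fintype.card V)
  have hδ : 0 ≤ δ := div_nonneg (by linarith) (by positivity)
  obtain ⟨w, hw⟩ := exists_empirical_mean_close
    (fun q : V × Bool => (|c q.1| + boolSign q.2 * c q.1) / 2 + δ)
    (fun q i => boolSign q.2 * a q.1 i) hB
    (fun q => by
      have h1 := neg_abs_le (c q.1)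
      have h2 := le_abs_self (c q.1)
      rcases q with ⟨v, b⟩
      cases b <;> simp [boolSign] at * <;> linarith)
    (by
      rw [Fintype.sum_prod_type]
      simp only [Fintype.sum_bool, boolSign, if_true, Bool.false_eq_true, if_false]
      have : ∀ v, (|c v| + 1 * c v) / 2 + δ + ((|c v| + -1 * c v) / 2 + δ) = |c v| + 2 * δ :=
        fun v => by ring
      simp only [this, Finset.sum_add_distrib, Finset.sum_const, Finset.card_univ, nsmul_eq_mul]
      simp only [δ]
      field_simp
      ring)
    (fun q i => by
      rcases q with ⟨v, b⟩
      cases b <;> simpa [boolSign] using ha v i) hm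
  refine ⟨w, fun i => ?_⟩
  convert hw i using 3
  rw [Fintype.sum_prod_type]
  refine Finset.sum_congr rfl fun v _ => ?_
  simp only [Fintype.sum_bool, boolSign, if_true, Bool.false_eq_true, if_false]
  ring

/-! ### The sparse ball and its partitions -/

/-- The `r`-sparse vectors of the Euclidean unit ball of `ℂⁿ`. -/
def sparseBall (n r : ℕ) : Set (EuclideanSpace ℂ (Fin n)) :=
  {z | ‖z‖ ≤ 1 ∧ ∃ T : Finset (Fin n), T.card ≤ r ∧ ∀ j ∉ T, z j = 0}

lemma sum_norm_le_of_mem_sparseBall {n r : ℕ} {z : EuclideanSpace ℂ (Fin n)}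
    (hz : z ∈ sparseBall n r) : ∑ j, ‖z j‖ ≤ √r := by
  obtain ⟨h1, T, hT, h2⟩ := hz
  have h3 : ∑ j, ‖z j‖ = ∑ j ∈ T, ‖z j‖ := by
    symm
    exact Finset.sum_subset (Finset.subset_univ T) fun j _ hj => by rw [h2 j hj, norm_zero]
  rw [h3]
  refine Real.le_sqrt_of_sq_le ?_
  calc (∑ j ∈ T, ‖z j‖) ^ 2 ≤ T.card * ∑ j ∈ T, ‖z j‖ ^ 2 := sq_sum_le_card_mul_sum_sq
    _ ≤ r * ∑ j, ‖z j‖ ^ 2 := by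
        gcongr
        exact Finset.subset_univ T
    _ = r * ‖z‖ ^ 2 := by rw [EuclideanSpace.norm_sq_eq]
    _ ≤ r * 1 := by gcongr; exact pow_le_one₀ (norm_nonneg _) h1
    _ = r := mul_one _

lemma inner_eq_sum_re_im {n : ℕ} (y z : EuclideanSpace ℂ (Fin n)) :
    inner ℂ y z = ∑ j, (((z j).re : ℂ) * star (y j) + ((z j).im : ℂ) * (Complex.I * star (y j))) := by
  rw [PiLp.inner_apply]
  refine Finset.sum_congr rfl fun j _ => ?_
  rw [RCLike.inner_apply]
  conv_lhs => rw [← Complex.re_add_im (z j)]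
  simp only [Complex.star_def]
  ring

/-- A partition of the sparse ball into few cells on which all functionals `⟨y i, ·⟩` are almost
constant. -/
lemma exists_key_inner_close {n r : ℕ} [NeZero n] {ι : Type*} [Fintype ι] [Nonempty ι]
    (y : ι → EuclideanSpace ℂ (Fin n)) {K : ℝ} (hK : 0 < K) (hy : ∀ i j, ‖y i j‖ ≤ K)
    (hr : 0 < r) {m : ℕ} (hm : 0 < m) :
    ∃ q : sparseBall n r → (Fin m → (Fin n × Bool) × Bool), ∀ z z', q z = q z' → ∀ i,
      ‖inner ℂ (y i) (z.1 - z'.1)‖ ≤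
        16 * K * √r * √(2 * Real.log (4 * Fintype.card ι) / m) := by
  let vec : Fin n × Bool → ι → ℂ := fun v i =>
    if v.2 then star (y i v.1) else Complex.I * star (y i v.1)
  have hvec : ∀ v i, ‖vec v i‖ ≤ K := by
    rintro ⟨j, b⟩ i
    cases b <;> simpa [vec] using hy i j
  let a : Fin n × Bool → ι × Bool → ℝ := fun v p =>
    if p.2 then (vec v p.1).re else (vec v p.1).im
  have ha : ∀ v p, |a v p| ≤ K := by
    rintro v ⟨i, b⟩
    cases b
    · simpa [a] using (Complex.abs_im_le_norm _).trans (hvec v i)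
    · simpa [a] using (Complex.abs_re_le_norm _).trans (hvec v i)
  -- Real and imaginary parts together have ℓ₁ norm at most 2‖z‖₁ ≤ 2√r; dividing by `S` gives an
  -- absolutely convex combination.
  set S : ℝ := 2 * √r with hS
  have hS0 : 0 < S := by have : (0 : ℝ) < r := by exact_mod_cast hr
                         positivity
  let c : EuclideanSpace ℂ (Fin n) → Fin n × Bool → ℝ := fun z v =>
    (if v.2 then (z v.1).re else (z v.1).im) / S
  have hc : ∀ z ∈ sparseBall n r, ∑ v, |c z v| ≤ 1 := by
    intro z hz
    rw [Fintype.sum_prod_type]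
    simp only [Fintype.sum_bool, c, if_true, Bool.false_eq_true, if_false, abs_div,
      abs_of_pos hS0]
    have h1 : ∀ j, |(z j).re| / S + |(z j).im| / S ≤ 2 * ‖z j‖ / S := by
      intro j
      rw [← add_div]
      gcongr
      linarith [Complex.abs_re_le_norm (z j), Complex.abs_im_le_norm (z j)]
    refine (Finset.sum_le_sum fun j _ => h1 j).trans ?_
    rw [← Finset.sum_div, ← Finset.mul_sum, div_le_one hS0]
    linarith [sum_norm_le_of_mem_sparseBall hz]
  have hinner : ∀ (z : EuclideanSpace ℂ (Fin n)) i,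
      (inner ℂ (y i) z).re = S * ∑ v, c z v * a v (i, true) ∧
      (inner ℂ (y i) z).im = S * ∑ v, c z v * a v (i, false) := by
    intro z i
    rw [inner_eq_sum_re_im, Complex.re_sum, Complex.im_sum, Fintype.sum_prod_type,
      Fintype.sum_prod_type, Finset.mul_sum, Finset.mul_sum]
    constructor <;> refine Finset.sum_congr rfl fun j _ => ?_
    all_goals
      simp only [Fintype.sum_bool, c, a, vec, if_true, Bool.false_eq_true, if_false,
        Complex.add_re, Complex.add_im, Complex.re_ofReal_mul, Complex.im_ofReal_mul]
      field_simp
  have hex : ∀ z : sparseBall n r, ∃ w : Fin m → (Fin n × Bool) × Bool, ∀ p,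
      |∑ v, c z v * a v p - (m : ℝ)⁻¹ * ∑ j, boolSign (w j).2 * a (w j).1 p| ≤
        2 * K * √(2 * Real.log (2 * Fintype.card (ι × Bool)) / m) := fun z =>
    exists_signed_empirical_mean_close (c z) a hK (hc z z.2) ha hm
  -- The key is the Maurey sample itself: two vectors with the same sample share an approximant. The
  -- constant 16 is 2 (triangle inequality) · 2 (Maurey) · 2 (from `S`) · 2 (real and imaginary
  -- parts).
  choose q hq using hex
  refine ⟨q, fun z z' hzz i => ?_⟩
  have hcard : (2 * Fintype.card (ι × Bool) : ℝ) = 4 * Fintype.card ι := by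
    simp only [Fintype.card_prod, Fintype.card_bool, Nat.cast_mul, Nat.cast_ofNat]
    ring
  rw [hcard] at hq
  set ρ := √(2 * Real.log (4 * Fintype.card ι) / m)
  have hp : ∀ p, |S * ∑ v, c z v * a v p - S * ∑ v, c z' v * a v p| ≤ S * (4 * K * ρ) := by
    intro p
    rw [← mul_sub, abs_mul, abs_of_pos hS0]
    gcongr
    have h1 := hq z p
    have h2 := hq z' p
    rw [← hzz] at h2
    rw [abs_le] at *
    constructor <;> linarith [h1.1, h1.2, h2.1, h2.2]
  have h1 := hp (i, true)
  have h2 := hp (i, false)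
  rw [← (hinner _ i).1, ← (hinner _ i).1, ← Complex.sub_re, ← inner_sub_right] at h1
  rw [← (hinner _ i).2, ← (hinner _ i).2, ← Complex.sub_im, ← inner_sub_right] at h2
  refine (Complex.norm_le_abs_re_add_abs_im _).trans ((add_le_add h1 h2).trans (le_of_eq ?_))
  rw [hS]; ring

lemma exists_enumeration_subset {n r : ℕ} [NeZero n] {T : Finset (Fin n)} (hT : T.card ≤ r) :
    ∃ t : Fin r → Fin n, ∀ j ∈ T, ∃ s, t s = j := by
  -- Unused positions are padded with 0, so that all supports are coded by tuples of the same
  -- length.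
  refine ⟨fun s => if h : s.1 < T.card then (T.equivFin.symm ⟨s, h⟩ : Fin n) else 0, ?_⟩
  intro j hj
  have hlt := (T.equivFin ⟨j, hj⟩).2
  refine ⟨⟨T.equivFin ⟨j, hj⟩, hlt.trans_le hT⟩, ?_⟩
  simp

/-- A partition of the sparse ball into Euclidean-small cells of vectors with a common support. -/
lemma exists_key_norm_close {n r : ℕ} [NeZero n] (hr : 0 < r) :
    ∃ q : sparseBall n r → (Fin r → Fin n × Fin (32 * r + 1) × Fin (32 * r + 1)),
      ∀ z z', q z = q z' → ‖z.1 - z'.1‖ ≤ 1 / 8 ∧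
        ∃ T : Finset (Fin n), T.card ≤ r ∧ ∀ j ∉ T, z.1 j = 0 ∧ z'.1 j = 0 := by
  have hex : ∀ z : sparseBall n r, ∃ t : Fin r → Fin n, ∀ j, z.1 j ≠ 0 → ∃ s, t s = j := by
    rintro ⟨z, -, T, hT, h⟩
    obtain ⟨t, ht⟩ := exists_enumeration_subset hT
    exact ⟨t, fun j hj => ht j (by by_contra hjT; exact hj (h j hjT))⟩
  choose t ht using hex
  have hr' : (1 : ℝ) ≤ r := by exact_mod_cast hr
  have hbd : ∀ x : ℝ, |x| ≤ 1 → ⌊16 * r * (x + 1)⌋₊ < 32 * r + 1 := by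
    intro x hx
    rw [Nat.lt_succ_iff]
    apply Nat.floor_le_of_le
    push_cast
    nlinarith [(abs_le.1 hx).2]
  -- The grid has mesh 1/(16r). Two parts on at most r coordinates then give squared distance at
  -- most r · 2/(128r) = (1/8)².
  have hfl : ∀ x x' : ℝ, |x| ≤ 1 → |x'| ≤ 1 → ⌊16 * r * (x + 1)⌋₊ = ⌊16 * r * (x' + 1)⌋₊ →
      (x - x') ^ 2 ≤ 1 / (128 * r) := by
    intro x x' hx hx' h
    have h0 : ∀ u : ℝ, |u| ≤ 1 → 0 ≤ 16 * r * (u + 1) := fun u hu =>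
      mul_nonneg (by positivity) (by linarith [(abs_le.1 hu).1])
    have h1 := Nat.floor_le (h0 x hx)
    have h2 := Nat.floor_le (h0 x' hx')
    have h3 := Nat.lt_floor_add_one (16 * r * (x + 1))
    have h4 := Nat.lt_floor_add_one (16 * r * (x' + 1))
    rw [h] at h1 h3
    have h5 : (16 * r * (x - x')) ^ 2 ≤ 1 := by
      rw [sq_le_one_iff_abs_le_one, abs_le]
      constructor <;> nlinarith
    rw [le_div_iff₀ (by positivity)]
    nlinarith [mul_nonneg (sq_nonneg (x - x')) (show (0 : ℝ) ≤ r by positivity),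
      mul_le_mul_of_nonneg_left hr' (mul_nonneg (sq_nonneg (x - x')) (show (0 : ℝ) ≤ r by positivity))]
  have hcoord : ∀ (z : sparseBall n r) j, ‖z.1 j‖ ≤ 1 := fun z j =>
    (PiLp.norm_apply_le z.1 j).trans z.2.1
  have hre : ∀ (z : sparseBall n r) j, |(z.1 j).re| ≤ 1 := fun z j =>
    (Complex.abs_re_le_norm _).trans (hcoord z j)
  have him : ∀ (z : sparseBall n r) j, |(z.1 j).im| ≤ 1 := fun z j =>
    (Complex.abs_im_le_norm _).trans (hcoord z j)
  refine ⟨fun z s => (t z s, ⟨_, hbd _ (hre z (t z s))⟩, ⟨_, hbd _ (him z (t z s))⟩), ?_⟩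
  intro z z' hzz
  have hkey : ∀ s, t z s = t z' s ∧
      ⌊16 * r * ((z.1 (t z s)).re + 1)⌋₊ = ⌊16 * r * ((z'.1 (t z' s)).re + 1)⌋₊ ∧
      ⌊16 * r * ((z.1 (t z s)).im + 1)⌋₊ = ⌊16 * r * ((z'.1 (t z' s)).im + 1)⌋₊ := by
    intro s
    simpa [Prod.ext_iff] using congrFun hzz s
  have htt : t z = t z' := funext fun s => (hkey s).1
  let T := Finset.univ.image (t z)
  have hTcard : T.card ≤ r := Finset.card_image_le.trans (by simp)
  have hT : ∀ j ∉ T, z.1 j = 0 ∧ z'.1 j = 0 := by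
    intro j hj
    constructor
    · by_contra h
      obtain ⟨s, hs⟩ := ht z j h
      exact hj (Finset.mem_image.2 ⟨s, Finset.mem_univ s, hs⟩)
    · by_contra h
      obtain ⟨s, hs⟩ := ht z' j h
      exact hj (Finset.mem_image.2 ⟨s, Finset.mem_univ s, by rw [htt, hs]⟩)
  refine ⟨?_, T, hTcard, hT⟩
  have hsq : ‖z.1 - z'.1‖ ^ 2 ≤ (1 / 8) ^ 2 := by
    rw [EuclideanSpace.norm_sq_eq, ← Finset.sum_subset (Finset.subset_univ T)
      fun j _ hj => by simp [hT j hj]]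
    calc _ ≤ ∑ j ∈ T, (2 / (128 * r) : ℝ) := by
          refine Finset.sum_le_sum fun j hj => ?_
          obtain ⟨s, -, rfl⟩ := Finset.mem_image.1 hj
          have h1 := hfl _ _ (hre z (t z s)) (hre z' (t z' s)) (hkey s).2.1
          have h2 := hfl _ _ (him z (t z s)) (him z' (t z' s)) (hkey s).2.2
          rw [← (hkey s).1] at h1 h2
          rw [Complex.sq_norm, Complex.normSq_apply]
          simp only [PiLp.sub_apply, Complex.sub_re, Complex.sub_im]
          calc _ = ((z.1 (t z s)).re - (z'.1 (t z s)).re) ^ 2 +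
                ((z.1 (t z s)).im - (z'.1 (t z s)).im) ^ 2 := by ring
            _ ≤ 1 / (128 * r) + 1 / (128 * r) := add_le_add h1 h2
            _ = _ := by ring
      _ = T.card * (2 / (128 * r)) := by simp
      _ ≤ r * (2 / (128 * r)) := by gcongr
      _ = _ := by field_simp; norm_num
  exact (sq_le_sq₀ (norm_nonneg _) (by norm_num)).1 hsq

/-! ### Chaining -/

/-- Factor |α|² - |β|² = (|α| + |β|)(|α| - |β|): the second factor is uniformly at most `u`, and the
first has ℓ₂ norm at most 2R. Thus uniform control of the functionals controls the ℓ₂ metric of the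
process. -/
lemma sum_sq_sub_le_of_inner_close {n r : ℕ} {ι : Type*} [Fintype ι]
    (y : ι → EuclideanSpace ℂ (Fin n)) {R u : ℝ} (hu : 0 ≤ u)
    (hR : ∀ z ∈ sparseBall n r, ∑ i, ‖inner ℂ (y i) z‖ ^ 2 ≤ R ^ 2)
    {z w : EuclideanSpace ℂ (Fin n)} (hz : z ∈ sparseBall n r) (hw : w ∈ sparseBall n r)
    (h : ∀ i, ‖inner ℂ (y i) (z - w)‖ ≤ u) :
    ∑ i, (‖inner ℂ (y i) z‖ ^ 2 - ‖inner ℂ (y i) w‖ ^ 2) ^ 2 ≤ (2 * R * u) ^ 2 := by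
  calc _ ≤ ∑ i, 2 * (‖inner ℂ (y i) z‖ ^ 2 + ‖inner ℂ (y i) w‖ ^ 2) * u ^ 2 := by
        refine Finset.sum_le_sum fun i _ => ?_
        have h1 : (‖inner ℂ (y i) z‖ - ‖inner ℂ (y i) w‖) ^ 2 ≤ u ^ 2 := by
          rw [sq_le_sq, abs_of_nonneg hu]
          refine (abs_norm_sub_norm_le _ _).trans ?_
          rw [← inner_sub_right]
          exact h i
        have h2 : (‖inner ℂ (y i) z‖ + ‖inner ℂ (y i) w‖) ^ 2 ≤
            2 * (‖inner ℂ (y i) z‖ ^ 2 + ‖inner ℂ (y i) w‖ ^ 2) := add_sq_le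
        calc _ = (‖inner ℂ (y i) z‖ + ‖inner ℂ (y i) w‖) ^ 2 *
              (‖inner ℂ (y i) z‖ - ‖inner ℂ (y i) w‖) ^ 2 := by ring
          _ ≤ _ := mul_le_mul h2 h1 (sq_nonneg _) (by positivity)
    _ = 2 * (∑ i, ‖inner ℂ (y i) z‖ ^ 2 + ∑ i, ‖inner ℂ (y i) w‖ ^ 2) * u ^ 2 := by
        rw [← Finset.sum_mul, ← Finset.mul_sum, Finset.sum_add_distrib]
    _ ≤ 2 * (R ^ 2 + R ^ 2) * u ^ 2 := by
        gcongr
        · exact hR z hz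
        · exact hR w hw
    _ = _ := by ring

lemma zero_mem_sparseBall (n r : ℕ) : (0 : EuclideanSpace ℂ (Fin n)) ∈ sparseBall n r :=
  ⟨by simp, ∅, by simp, by simp⟩

lemma norm_inner_le_of_mem_sparseBall {n r : ℕ} {y z : EuclideanSpace ℂ (Fin n)} {K : ℝ}
    (hy : ∀ j, ‖y j‖ ≤ K) (hK : 0 ≤ K) (hz : z ∈ sparseBall n r) : ‖inner ℂ y z‖ ≤ K * √r := by
  rw [PiLp.inner_apply]
  calc _ ≤ ∑ j, ‖inner ℂ (y j) (z j)‖ := norm_sum_le _ _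
    _ ≤ ∑ j, K * ‖z j‖ := Finset.sum_le_sum fun j _ =>
        (norm_inner_le_norm _ _).trans (mul_le_mul_of_nonneg_right (hy j) (norm_nonneg _))
    _ ≤ _ := by
        rw [← Finset.mul_sum]
        exact mul_le_mul_of_nonneg_left (sum_norm_le_of_mem_sparseBall hz) hK

lemma sqrt_div_four_pow (x : ℝ) (l : ℕ) : √(x / 4 ^ l) = √x / 2 ^ l := by
  rw [Real.sqrt_div' _ (by positivity)]
  congr 1
  rw [show (4 : ℝ) ^ l = (2 ^ l) ^ 2 by rw [← pow_mul, mul_comm, pow_mul]; norm_num]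
  exact Real.sqrt_sq (by positivity)

lemma mul_sqrt_le_mul_sqrt {a c x Λ : ℝ} (hx : x ≤ c ^ 2 * Λ) (ha : 0 ≤ a) (hc : 0 ≤ c) :
    a * √x ≤ a * c * √Λ := by
  rw [mul_assoc]
  gcongr
  calc √x ≤ √(c ^ 2 * Λ) := Real.sqrt_le_sqrt hx
    _ = c * √Λ := by rw [Real.sqrt_mul (by positivity), Real.sqrt_sq hc]

/-- Chaining bound for the Rademacher process `∑ ± |⟨y i, z⟩|²` over a net of the sparse ball. -/
theorem exists_net_rademacherBound {n r : ℕ} (hr : 0 < r) (hrn : r ≤ n) {ι : Type*} [Fintype ι]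
    [DecidableEq ι] [Nonempty ι] (y : ι → EuclideanSpace ℂ (Fin n)) {K R : ℝ} (hK : 0 < K)
    (hy : ∀ i j, ‖y i j‖ ≤ K) (hR0 : 0 ≤ R)
    (hR : ∀ z ∈ sparseBall n r, ∑ i, ‖inner ℂ (y i) z‖ ^ 2 ≤ R ^ 2) :
    ∃ π : sparseBall n r → sparseBall n r,
      (∀ z, ‖z.1 - (π z).1‖ ≤ 1 / 8 ∧
        ∃ T : Finset (Fin n), T.card ≤ r ∧ ∀ j ∉ T, z.1 j = 0 ∧ (π z).1 j = 0) ∧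
      RademacherBound (Set.range fun z i => ‖inner ℂ (y i) (π z).1‖ ^ 2)
        ((14 * Nat.clog 2 r + 12) *
          (R * (16 * K * √r * √(2 * Real.log (4 * Fintype.card ι))) * √(Real.log (4 * n)))) := by
  have : NeZero n := ⟨by omega⟩
  have hn : (1 : ℝ) ≤ n := by exact_mod_cast (by omega : 1 ≤ n)
  have hr1 : (1 : ℝ) ≤ r := by exact_mod_cast hr
  have hrn' : (r : ℝ) ≤ n := by exact_mod_cast hrn
  have hι : (1 : ℝ) ≤ Fintype.card ι := by exact_mod_cast Fintype.card_pos
  set D := sparseBall n r with hD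
  have : Nonempty D := ⟨⟨0, zero_mem_sparseBall n r⟩⟩
  set U := 16 * K * √r * √(2 * Real.log (4 * Fintype.card ι)) with hU
  set Λ := Real.log (4 * n) with hΛ
  have hlog2 : 0 < Real.log 2 := Real.log_pos (by norm_num)
  have hΛ2 : Real.log 2 ≤ Λ := Real.log_le_log (by norm_num) (by linarith)
  have hΛ0 : 0 < Λ := by linarith
  have hU0 : 0 ≤ U := by positivity
  choose q hq using fun l : ℕ => exists_key_inner_close y hK hy hr (m := 4 ^ l) (by positivity)
  have hq' : ∀ l z z', q l z = q l z' → ∀ i, ‖inner ℂ (y i) (z.1 - z'.1)‖ ≤ U / 2 ^ l := by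
    intro l z z' h i
    have := hq l z z' h i
    rw [Nat.cast_pow, Nat.cast_ofNat, sqrt_div_four_pow] at this
    rwa [hU, mul_div_assoc]
  obtain ⟨qN, hqN⟩ := exists_key_norm_close (n := n) hr
  -- Chosen representatives of the level-`l` cells; these are the links of the chain.
  let p : ℕ → D → D := fun l z => Function.invFun (q l) (q l z)
  have hp : ∀ l z, q l (p l z) = q l z := fun l z => Function.invFun_eq ⟨z, rfl⟩
  have hpk : ∀ l z z', q l z = q l z' → p l z = p l z' := fun l z z' h => by simp only [p, h]
  let π : D → D := fun z => Function.invFun qN (qN z)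
  have hπ : ∀ z, qN (π z) = qN z := fun z => Function.invFun_eq ⟨z, rfl⟩
  have hπk : ∀ z z', qN z = qN z' → π z = π z' := fun z z' h => by simp only [π, h]
  refine ⟨π, fun z => hqN z (π z) (hπ z).symm, ?_⟩
  let c : D → ι → ℝ := fun z i => ‖inner ℂ (y i) z.1‖ ^ 2
  have hcard : ∀ l, Fintype.card (Fin (4 ^ l) → (Fin n × Bool) × Bool) = (4 * n) ^ (4 ^ l) := by
    intro l
    simp only [Fintype.card_pi, Fintype.card_prod, Fintype.card_bool, Fintype.card_fin,
      Finset.prod_const, Finset.card_univ]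
    congr 1; ring
  -- The first link is compared with the zero vector, legitimate because K√r ≤ U.
  have hstart : RademacherBound (Set.range fun z => c (p 0 z)) (2 * R * U * 2 * √Λ) := by
    refine (rademacherBound_range_of_key (q 0) (fun z => c (p 0 z)) (σ := 2 * R * U) (N := 4 * n)
      (fun z z' h => by rw [hpk 0 z z' h]) (by positivity) (fun z => ?_)
      (by rw [hcard]; simp)).mono le_rfl ?_
    · have hlog4 : 1 ≤ 2 * Real.log (4 * Fintype.card ι) := by
        have h1 : Real.log 4 ≤ Real.log (4 * Fintype.card ι) :=
          Real.log_le_log (by norm_num) (by linarith)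
        have h2 : Real.log 4 = 2 * Real.log 2 := by
          rw [show (4 : ℝ) = 2 ^ 2 by norm_num, Real.log_pow]; norm_num
        linarith [Real.log_two_gt_d9]
      have hKU : K * √r ≤ U := by
        rw [hU]
        have : 1 ≤ √(2 * Real.log (4 * Fintype.card ι)) := Real.one_le_sqrt.2 hlog4
        have h3 : 0 ≤ K * √r := by positivity
        nlinarith
      have := sum_sq_sub_le_of_inner_close (r := r) y hU0 hR (p 0 z).2 (zero_mem_sparseBall n r)
        fun i => by
          rw [sub_zero]
          exact (norm_inner_le_of_mem_sparseBall (hy i) hK.le (p 0 z).2).trans hKU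
      simpa [c] using this
    · apply mul_sqrt_le_mul_sqrt _ (by positivity) (by norm_num)
      rw [Real.log_mul (by norm_num) (by positivity)]
      linarith
  -- Increment size 4RU/2^l against log-cardinality 5 · 4^l · Λ: the powers of 2 cancel, so the
  -- bound does not depend on `l`.
  have hmid : ∀ l < Nat.clog 2 r, RademacherBound
      (Set.range fun z => c (p (l + 1) z) - c (p l z)) (14 * (R * U * √Λ)) := by
    intro l _
    refine (rademacherBound_range_of_key (fun z => (q (l + 1) z, q l z))
      (fun z => c (p (l + 1) z) - c (p l z)) (σ := 4 * R * U / 2 ^ l)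
      (N := (4 * n) ^ (5 * 4 ^ l))
      (fun z z' h => ?_) (by positivity) (fun z => ?_) ?_).mono le_rfl ?_
    · rw [Prod.ext_iff] at h
      simp only [hpk _ z z' h.1, hpk _ z z' h.2]
    · have := sum_sq_sub_le_of_inner_close (r := r) y (u := 2 * U / 2 ^ l) (by positivity) hR
        (p (l + 1) z).2 (p l z).2 fun i => by
          have h1 := hq' (l + 1) _ _ (hp (l + 1) z) i
          have h2 := hq' l _ _ (hp l z).symm i
          have h3 : (p (l + 1) z).1 - (p l z).1 = ((p (l + 1) z).1 - z.1) + (z.1 - (p l z).1) := by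
            abel
          rw [h3, inner_add_right]
          refine (norm_add_le _ _).trans ((add_le_add h1 h2).trans ?_)
          have h4 : U / 2 ^ (l + 1) ≤ U / 2 ^ l := by
            gcongr <;> norm_num
          calc _ ≤ U / 2 ^ l + U / 2 ^ l := by gcongr
            _ = _ := by ring
      refine (le_of_eq ?_).trans (this.trans (le_of_eq (by ring)))
      simp [c]
    · rw [Fintype.card_prod, hcard, hcard, ← pow_add, pow_succ]
      push_cast
      rw [show 4 ^ l * 4 + 4 ^ l = 5 * 4 ^ l by ring]
    · calc _ ≤ 4 * R * U / 2 ^ l * (7 / 2 * 2 ^ l) * √Λ := by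
            apply mul_sqrt_le_mul_sqrt _ (by positivity) (by positivity)
            rw [Real.log_mul (by norm_num) (by positivity), Real.log_pow, ← hΛ, mul_pow,
              ← pow_mul, mul_comm l 2, pow_mul]
            push_cast
            have h1 : (1 : ℝ) ≤ 4 ^ l := one_le_pow₀ (by norm_num)
            have h2 : (2 ^ 2 : ℝ) ^ l = 4 ^ l := by norm_num
            rw [h2]
            nlinarith [mul_le_mul_of_nonneg_right h1 hΛ0.le]
        _ = _ := by field_simp; ring
  -- The last link is counted by the cells of the Euclidean net, of log-cardinality at most 7rΛ,
  -- which r ≤ 4^L compensates.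
  have hend : RademacherBound (Set.range fun z => c (π z) - c (p (Nat.clog 2 r) (π z)))
      (8 * (R * U * √Λ)) := by
    set L := Nat.clog 2 r with hL
    have hrL : (r : ℝ) ≤ 4 ^ L := by
      have h1 : r ≤ 2 ^ L := Nat.le_pow_clog (by norm_num) r
      have h2 : (r : ℝ) ≤ 2 ^ L := by exact_mod_cast h1
      exact h2.trans (pow_le_pow_left₀ (by norm_num) (by norm_num) L)
    refine (rademacherBound_range_of_key qN (fun z => c (π z) - c (p L (π z)))
      (σ := 2 * R * (U / 2 ^ L)) (N := (4 * n) ^ (7 * r))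
      (fun z z' h => by simp only [hπk z z' h]) (by positivity) (fun z => ?_) ?_).mono le_rfl ?_
    · refine le_trans (le_of_eq ?_) (sum_sq_sub_le_of_inner_close (r := r) y
        (u := U / 2 ^ L) (by positivity) hR (π z).2 (p L (π z)).2
        fun i => hq' L _ _ (hp L (π z)).symm i)
      simp [c]
    · simp only [Fintype.card_pi, Fintype.card_prod, Fintype.card_fin, Finset.prod_const,
        Finset.card_univ]
      push_cast
      rw [pow_mul]
      gcongr
      have h1 : (32 * r + 1 : ℝ) ≤ (4 * n) ^ 3 := by
        have : (n : ℝ) ≤ n ^ 3 := le_self_pow₀ hn (by norm_num)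
        nlinarith
      calc (n : ℝ) * ((32 * r + 1) * (32 * r + 1)) ≤ (4 * n) * ((4 * n) ^ 3 * (4 * n) ^ 3) := by
            gcongr; linarith
        _ = _ := by ring
    · calc _ ≤ 2 * R * (U / 2 ^ L) * (4 * 2 ^ L) * √Λ := by
            apply mul_sqrt_le_mul_sqrt _ (by positivity) (by positivity)
            rw [Real.log_mul (by norm_num) (by positivity), Real.log_pow, ← hΛ, mul_pow,
              ← pow_mul, mul_comm L 2, pow_mul]
            push_cast
            have h2 : (2 ^ 2 : ℝ) ^ L = 4 ^ L := by norm_num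
            rw [h2]
            nlinarith [mul_le_mul_of_nonneg_right hrL hΛ0.le,
              mul_le_mul_of_nonneg_right hr1 hΛ0.le]
        _ = _ := by field_simp; ring
  have hsum := RademacherBound.sum_range (fun l z => c (p (l + 1) z) - c (p l z)) _ _ hmid
  have h1 := hsum.add hstart (H := Set.range fun z => c (p (Nat.clog 2 r) z)) (by
    rintro _ ⟨z, rfl⟩
    refine ⟨_, ⟨z, rfl⟩, _, ⟨z, rfl⟩, ?_⟩
    simp only
    rw [Finset.sum_range_sub (fun l => c (p l z))]
    abel)
  -- The chain is run from the net point `π z`, not from `z`. The constants add up as 14L + 4 + 8.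
  refine (hend.add h1 ?_).mono le_rfl (le_of_eq ?_)
  · rintro _ ⟨z, rfl⟩
    exact ⟨_, ⟨z, rfl⟩, _, ⟨π z, rfl⟩, by simp only [sub_add_cancel]; rfl⟩
  · ring

/-! ### Operators on coordinate subspaces and quadratic forms -/

/-- Families of operators on the coordinate subspaces `ℂ^T`, `|T| ≤ r`, with the supremum norm. -/
abbrev CoordOperators (n r : ℕ) : Type :=
  (T : {T : Finset (Fin n) // T.card ≤ r}) →
    (EuclideanSpace ℂ T.1 →L[ℂ] EuclideanSpace ℂ T.1)

/-- The family of rank-one operators `x^T ⊗ x^T`. -/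
noncomputable def coordTensor {n : ℕ} (r : ℕ) (x : EuclideanSpace ℂ (Fin n)) :
    CoordOperators n r :=
  fun T => tensorSelf (restrictCoords T.1 x)

lemma inner_tensorSelf_apply_self {ι : Type*} [Fintype ι] (v w : EuclideanSpace ℂ ι) :
    inner ℂ (tensorSelf v w) w = ((‖inner ℂ v w‖ ^ 2 : ℝ) : ℂ) := by
  rw [tensorSelf, InnerProductSpace.rankOne_apply, inner_smul_left]
  push_cast
  exact RCLike.conj_mul _

lemma inner_restrictCoords {n : ℕ} {T : Finset (Fin n)} {z : EuclideanSpace ℂ (Fin n)}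
    (hz : ∀ j ∉ T, z j = 0) (y : EuclideanSpace ℂ (Fin n)) :
    inner ℂ (restrictCoords T y) (restrictCoords T z) = inner ℂ y z := by
  rw [PiLp.inner_apply, PiLp.inner_apply]
  simp only [restrictCoords]
  rw [Finset.sum_coe_sort T (fun j => inner ℂ (y j) (z j))]
  exact Finset.sum_subset (Finset.subset_univ T) fun j _ hj => by rw [hz j hj, inner_zero_right]

lemma norm_restrictCoords {n : ℕ} {T : Finset (Fin n)} {z : EuclideanSpace ℂ (Fin n)}
    (hz : ∀ j ∉ T, z j = 0) : ‖restrictCoords T z‖ = ‖z‖ := by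
  rw [norm_eq_sqrt_re_inner (𝕜 := ℂ), norm_eq_sqrt_re_inner (𝕜 := ℂ) z, inner_restrictCoords hz]

lemma exists_restrictCoords_eq {n : ℕ} {T : Finset (Fin n)} (w : EuclideanSpace ℂ T) :
    ∃ z : EuclideanSpace ℂ (Fin n), (∀ j ∉ T, z j = 0) ∧ restrictCoords T z = w := by
  refine ⟨WithLp.toLp 2 fun j => if h : j ∈ T then w ⟨j, h⟩ else 0, fun j hj => by simp [hj], ?_⟩
  ext t
  simp [restrictCoords]

section
variable {n r : ℕ} {ι : Type*} [Fintype ι]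

lemma inner_sum_coordTensor_apply_self (s : ι → ℝ) (y : ι → EuclideanSpace ℂ (Fin n))
    (T : {T : Finset (Fin n) // T.card ≤ r}) {z : EuclideanSpace ℂ (Fin n)}
    (hz : ∀ j ∉ T.1, z j = 0) :
    inner ℂ ((∑ i, s i • coordTensor r (y i)) T (restrictCoords T.1 z)) (restrictCoords T.1 z) =
      ((∑ i, s i * ‖inner ℂ (y i) z‖ ^ 2 : ℝ) : ℂ) := by
  simp only [Finset.sum_apply, Pi.smul_apply, sum_apply,
    sum_apply, smul_apply, sum_inner, Complex.ofReal_sum]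
  refine Finset.sum_congr rfl fun i _ => ?_
  rw [coordTensor, inner_smul_left_eq_smul, inner_tensorSelf_apply_self, inner_restrictCoords hz,
    Complex.ofReal_mul, Complex.real_smul]

lemma isSymmetric_sum_coordTensor (s : ι → ℝ) (y : ι → EuclideanSpace ℂ (Fin n))
    (T : {T : Finset (Fin n) // T.card ≤ r}) :
    ((∑ i, s i • coordTensor r (y i)) T).IsSymmetric := by
  rw [LinearMap.isSymmetric_iff_inner_map_self_real]
  intro w
  obtain ⟨z, hz, rfl⟩ := exists_restrictCoords_eq w
  rw [ContinuousLinearMap.coe_coe, inner_sum_coordTensor_apply_self s y T hz, Complex.conj_ofReal]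

lemma abs_sum_le_norm_sum_coordTensor (s : ι → ℝ) (y : ι → EuclideanSpace ℂ (Fin n))
    {z : EuclideanSpace ℂ (Fin n)} (hz : z ∈ sparseBall n r) :
    |∑ i, s i * ‖inner ℂ (y i) z‖ ^ 2| ≤ ‖∑ i, s i • coordTensor r (y i)‖ := by
  obtain ⟨h1, T, hT, h2⟩ := hz
  have h3 := congrArg norm (inner_sum_coordTensor_apply_self s y ⟨T, hT⟩ h2)
  rw [Complex.norm_real, Real.norm_eq_abs] at h3
  rw [← h3]
  refine (norm_inner_le_norm _ _).trans ?_
  rw [norm_restrictCoords h2]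
  refine (mul_le_of_le_one_right (norm_nonneg _) h1).trans ?_
  refine (ContinuousLinearMap.le_opNorm _ _).trans ?_
  rw [norm_restrictCoords h2]
  exact (mul_le_of_le_one_right (norm_nonneg _) h1).trans (norm_le_pi_norm _ _)

/-- Each component is self-adjoint, so its norm is the supremum of its Rayleigh quotients, and a
unit vector of ℂ^T extended by zero lies in the sparse ball. -/
lemma norm_sum_coordTensor_le (s : ι → ℝ) (y : ι → EuclideanSpace ℂ (Fin n)) {B : ℝ} (hB : 0 ≤ B)
    (h : ∀ z ∈ sparseBall n r, |∑ i, s i * ‖inner ℂ (y i) z‖ ^ 2| ≤ B) :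
    ‖∑ i, s i • coordTensor r (y i)‖ ≤ B := by
  refine (pi_norm_le_iff_of_nonneg hB).2 fun T => ?_
  rw [ContinuousLinearMap.norm_eq_iSup_rayleighQuotient _ (isSymmetric_sum_coordTensor s y T)]
  refine ciSup_le fun w => ?_
  by_cases hw : w = 0
  · rw [hw, ContinuousLinearMap.rayleighQuotient_apply_zero, abs_zero]
    exact hB
  have hw' : ‖w‖ ≠ 0 := norm_ne_zero_iff.2 hw
  rw [← ContinuousLinearMap.rayleigh_smul _ w (c := ((‖w‖⁻¹ : ℝ) : ℂ)) (by simpa using hw)]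
  set w₁ := ((‖w‖⁻¹ : ℝ) : ℂ) • w with hw1
  have hn : ‖w₁‖ = 1 := by
    rw [hw1, norm_smul, Complex.norm_real, norm_inv, norm_norm, inv_mul_cancel₀ hw']
  obtain ⟨z, hz, hzw⟩ := exists_restrictCoords_eq w₁
  rw [ContinuousLinearMap.rayleighQuotient, ContinuousLinearMap.reApplyInnerSelf_apply, hn, ← hzw,
    inner_sum_coordTensor_apply_self s y T hz]
  simp only [one_pow, div_one, RCLike.re_to_complex, Complex.ofReal_re]
  exact h z ⟨by rw [← norm_restrictCoords hz, hzw, hn], T.1, T.2, hz⟩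

end

/-! ### Rudelson's inequality -/

/-- Passing from a `1/8`-net to the whole sparse ball for a quadratic form. -/
lemma abs_quadratic_le_add_half {n r : ℕ} {ι : Type*} [Fintype ι] (s : ι → ℝ)
    (y : ι → EuclideanSpace ℂ (Fin n)) {M : ℝ}
    (hM : ∀ z ∈ sparseBall n r, |∑ i, s i * ‖inner ℂ (y i) z‖ ^ 2| ≤ M)
    {z w : EuclideanSpace ℂ (Fin n)} (hz : z ∈ sparseBall n r) (hw : w ∈ sparseBall n r)
    (hzw : ‖z - w‖ ≤ 1 / 8) {T : Finset (Fin n)} (hT : T.card ≤ r)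
    (hsupp : ∀ j ∉ T, z j = 0 ∧ w j = 0) :
    |∑ i, s i * ‖inner ℂ (y i) z‖ ^ 2| ≤ |∑ i, s i * ‖inner ℂ (y i) w‖ ^ 2| + M / 2 := by
  -- Polarization of |⟨y, z⟩|² - |⟨y, w⟩|², with z - w and z + w rescaled by 4 and 1/4 to norm at
  -- most 1/2. The common support keeps a ± b sparse, and the form costs (M + M)/4.
  let a : EuclideanSpace ℂ (Fin n) := (4 : ℂ) • (z - w)
  let b : EuclideanSpace ℂ (Fin n) := (1 / 4 : ℂ) • (z + w)
  have ha : ‖a‖ ≤ 1 / 2 := by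
    simp only [a, norm_smul, RCLike.norm_ofNat]; linarith
  have hb : ‖b‖ ≤ 1 / 2 := by
    have : ‖z + w‖ ≤ 2 := (norm_add_le _ _).trans (by linarith [hz.1, hw.1])
    simp only [b, norm_smul, norm_div, norm_one, RCLike.norm_ofNat]; linarith
  have hp : a + b ∈ sparseBall n r :=
    ⟨(norm_add_le _ _).trans (by linarith), T, hT, fun j hj => by simp [a, b, hsupp j hj]⟩
  have hm : a - b ∈ sparseBall n r :=
    ⟨(norm_sub_le _ _).trans (by linarith), T, hT, fun j hj => by simp [a, b, hsupp j hj]⟩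
  have hid : ∀ i, ‖inner ℂ (y i) z‖ ^ 2 = ‖inner ℂ (y i) w‖ ^ 2 +
      (‖inner ℂ (y i) (a + b)‖ ^ 2 - ‖inner ℂ (y i) (a - b)‖ ^ 2) / 4 := by
    intro i
    simp only [a, b, inner_add_right, inner_sub_right, inner_smul_right]
    simp only [Complex.sq_norm, Complex.normSq_apply]
    simp
    ring
  have h1 : ∑ i, s i * ‖inner ℂ (y i) z‖ ^ 2 = ∑ i, s i * ‖inner ℂ (y i) w‖ ^ 2 +
      (∑ i, s i * ‖inner ℂ (y i) (a + b)‖ ^ 2 - ∑ i, s i * ‖inner ℂ (y i) (a - b)‖ ^ 2) / 4 := by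
    rw [← Finset.sum_sub_distrib, Finset.sum_div, ← Finset.sum_add_distrib]
    exact Finset.sum_congr rfl fun i _ => by rw [hid i]; ring
  rw [h1]
  have h2 := abs_le.1 (hM _ hp)
  have h3 := abs_le.1 (hM _ hm)
  refine (abs_add_le _ _).trans (add_le_add le_rfl ?_)
  rw [abs_le]
  constructor <;> linarith

/-- Rudelson's inequality, uniformly over small coordinate subspaces. -/
theorem expect_norm_rademacher_coordTensor_le {n r : ℕ} (hr : 0 < r) (hrn : r ≤ n) {ι : Type*}
    [Fintype ι] [DecidableEq ι] [Nonempty ι] (y : ι → EuclideanSpace ℂ (Fin n)) {K : ℝ}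
    (hK : 0 < K) (hy : ∀ i j, ‖y i j‖ ≤ K) :
    𝔼 e : ι → Bool, ‖∑ i, boolSign (e i) • coordTensor r (y i)‖ ≤
      2 * ((14 * Nat.clog 2 r + 12) * (√‖∑ i, coordTensor r (y i)‖ *
        (16 * K * √r * √(2 * Real.log (4 * Fintype.card ι))) * √(Real.log (4 * n)))) := by
  obtain ⟨π, hπ, Y, hY, hYB⟩ := exists_net_rademacherBound hr hrn y hK hy
    (R := √‖∑ i, coordTensor r (y i)‖) (Real.sqrt_nonneg _) (fun z hz => by
      rw [Real.sq_sqrt (norm_nonneg _)]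
      have := abs_sum_le_norm_sum_coordTensor (fun _ => 1) y hz
      simp only [one_mul, one_smul] at this
      exact (le_abs_self _).trans this)
  refine le_trans ?_ (mul_le_mul_of_nonneg_left hYB zero_le_two)
  rw [Finset.mul_expect]
  refine Finset.expect_le_expect fun e _ => ?_
  have hM : ∀ z ∈ sparseBall n r, |∑ i, boolSign (e i) * ‖inner ℂ (y i) z‖ ^ 2| ≤
      ‖∑ i, boolSign (e i) • coordTensor r (y i)‖ := fun z hz =>
    abs_sum_le_norm_sum_coordTensor _ y hz
  have hY0 : 0 ≤ Y e := (abs_nonneg _).trans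
    (hY e _ ⟨⟨0, zero_mem_sparseBall n r⟩, rfl⟩)
  have := norm_sum_coordTensor_le (r := r) (fun i => boolSign (e i)) y
    (B := Y e + ‖∑ i, boolSign (e i) • coordTensor r (y i)‖ / 2) (by positivity) fun z hz => by
      obtain ⟨h1, T, hT, hsupp⟩ := hπ ⟨z, hz⟩
      exact (abs_quadratic_le_add_half _ y hM hz (π ⟨z, hz⟩).2 h1 hT hsupp).trans
        (add_le_add (hY e _ ⟨⟨z, hz⟩, rfl⟩) le_rfl)
  -- The norm is at most `Y e` plus half of itself, whence the factor 2.
  linarith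

/-! ### Numerical estimates -/

lemma clog_two_le_mul_log {r : ℕ} (hr : 2 ≤ r) :
    (14 * Nat.clog 2 r + 12 : ℝ) ≤ 60 * Real.log r := by
  have h1 : 2 ^ (Nat.clog 2 r - 1) < r := Nat.pow_pred_clog_lt_self (by norm_num) (by omega)
  have h2 : ((2 : ℝ) ^ (Nat.clog 2 r - 1)) ≤ r := by exact_mod_cast h1.le
  have h3 := Real.log_le_log (by positivity) h2
  rw [Real.log_pow] at h3
  have h4 : 1 ≤ Nat.clog 2 r := Nat.clog_pos (by norm_num) hr
  rw [Nat.cast_sub h4, Nat.cast_one] at h3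
  have h5 : Real.log 2 ≤ Real.log r := Real.log_le_log (by norm_num) (by exact_mod_cast hr)
  have h6 := Real.log_two_gt_d9
  nlinarith

lemma log_four_mul_le {m : ℕ} (hm : 2 ≤ m) : Real.log (4 * m) ≤ 3 * Real.log m := by
  have h1 : (2 : ℝ) ≤ m := by exact_mod_cast hm
  have h2 : Real.log 2 ≤ Real.log m := Real.log_le_log (by norm_num) h1
  have h3 : Real.log 4 = 2 * Real.log 2 := by
    rw [show (4 : ℝ) = 2 ^ 2 by norm_num, Real.log_pow]; norm_num
  rw [Real.log_mul (by norm_num) (by positivity)]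
  linarith

/-- Inverting `k ≥ C a log a` to `k ≥ Q a log k`. -/
lemma mul_log_le_of_mul_log_le {Q a ρ k : ℝ} (hQ : 1 ≤ Q) (ha : 1 ≤ a) (hρ0 : 0 ≤ ρ)
    (hρ : ρ ≤ 3 / 2 * a) (hlow : 1 / 10 ≤ a * Real.log a * ρ ^ 2)
    (hk : (8 * Q + 10 * (18 * Q) ^ 2) * a * Real.log a * ρ ^ 2 ≤ k) :
    Q * a * ρ ^ 2 * Real.log k ≤ k := by
  -- This is what the summand 10(18Q)² of the constant is for.
  have hk2 : (18 * Q) ^ 2 ≤ k := by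
    have h1 : (8 * Q + 10 * (18 * Q) ^ 2) * (1 / 10) ≤
        (8 * Q + 10 * (18 * Q) ^ 2) * (a * Real.log a * ρ ^ 2) := by gcongr
    linarith
  have hk0 : 0 < k := by nlinarith
  -- If k ≤ a⁸, then log k is comparable to log a. Otherwise a, ρ and log k are all at most
  -- multiples of e = k^(1/8), and the left side is at most 18Q√k ≤ k.
  rcases le_or_gt (Real.log k) (8 * Real.log a) with h | h
  · calc Q * a * ρ ^ 2 * Real.log k ≤ Q * a * ρ ^ 2 * (8 * Real.log a) := by gcongr
      _ = 8 * Q * (a * Real.log a * ρ ^ 2) := by ring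
      _ ≤ (8 * Q + 10 * (18 * Q) ^ 2) * (a * Real.log a * ρ ^ 2) := by
          gcongr
          nlinarith
      _ ≤ k := by linarith
  · set e := Real.exp (Real.log k / 8) with he
    have he0 : 0 < e := Real.exp_pos _
    have hlog : Real.log k ≤ 8 * e := by linarith [Real.add_one_le_exp (Real.log k / 8)]
    have hae : a ≤ e := by
      rw [← Real.exp_log (show 0 < a by linarith), he]
      exact Real.exp_le_exp.2 (by linarith)
    have hke : k = e ^ 8 := by
      rw [he, ← Real.exp_nat_mul]
      push_cast
      rw [mul_div_cancel₀ _ (by norm_num), Real.exp_log hk0]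
    have h4 : 18 * Q ≤ e ^ 4 := by
      rw [← sq_le_sq₀ (by positivity) (by positivity), ← pow_mul]
      exact hk2.trans hke.le
    calc Q * a * ρ ^ 2 * Real.log k ≤ Q * e * (3 / 2 * e) ^ 2 * (8 * e) := by
          have : ρ ≤ 3 / 2 * e := by linarith
          have : 0 ≤ Real.log k := by linarith [Real.log_nonneg ha]
          gcongr
      _ = 18 * Q * e ^ 4 := by ring
      _ ≤ e ^ 4 * e ^ 4 := by gcongr
      _ = k := by rw [hke]; ring

/-! ### Self-bounding and conclusion -/

/-- The family of identity operators. -/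
noncomputable def coordId (n r : ℕ) : CoordOperators n r :=
  fun _ => ContinuousLinearMap.id ℂ _

/-- Compressing the resolution of the identity to each ℂ^T identifies `coordId` as the mean needed
for symmetrization. -/
lemma sum_coordTensor_eq_smul_id {n r : ℕ} (x : Fin n → EuclideanSpace ℂ (Fin n))
    (hx : ContinuousLinearMap.id ℂ (EuclideanSpace ℂ (Fin n)) =
      ((1 : ℂ) / (n : ℂ)) • ∑ i, tensorSelf (x i)) :
    (n : ℝ) • coordId n r =
      ∑ i, coordTensor r (x i) := by
  rcases Nat.eq_zero_or_pos n with rfl | hn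
  · simp
  have hn' : (n : ℂ) ≠ 0 := by exact_mod_cast hn.ne'
  funext T
  ext w : 1
  obtain ⟨z, hz, rfl⟩ := exists_restrictCoords_eq w
  have h1 : ∑ i, inner ℂ (x i) z • x i = (n : ℂ) • z := by
    have := congrArg (fun A => (n : ℂ) • A z) hx
    simp only [smul_apply, sum_apply, tensorSelf, InnerProductSpace.rankOne_apply, smul_smul,
      mul_one_div_cancel hn', one_smul, ContinuousLinearMap.id_apply] at this
    exact this.symm
  ext t
  have h2 := congrArg (fun v => v t.1) h1
  simp only [Finset.sum_apply, Pi.smul_apply, smul_apply, sum_apply, coordTensor, coordId, tensorSelf,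
    InnerProductSpace.rankOne_apply, inner_restrictCoords hz, ContinuousLinearMap.id_apply]
  simp only [PiLp.smul_apply, WithLp.ofLp_sum, Finset.sum_apply, smul_eq_mul, restrictCoords,
    WithLp.ofLp_smul, Pi.smul_apply] at h2 ⊢
  rw [h2]
  simp

lemma uniformDeviation_le {n r k : ℕ} (hk : 1 ≤ k) (x : Fin n → EuclideanSpace ℂ (Fin n))
    {Ω : Finset (Fin n)} (hΩ : Ω.card = k) :
    uniformDeviation x r k Ω ≤ (k : ℝ)⁻¹ * ‖∑ i ∈ Ω,
      (coordTensor r (x i) - coordId n r)‖ := by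
  have hk' : (k : ℝ) ≠ 0 := by positivity
  have : Nonempty {T : Finset (Fin n) // T.card ≤ r} := ⟨⟨∅, by simp⟩⟩
  refine ciSup_le fun T => ?_
  rw [← Real.norm_of_nonneg (show 0 ≤ (k : ℝ)⁻¹ by positivity), ← norm_smul,
    Finset.sum_sub_distrib, ← norm_neg, Finset.sum_const, hΩ]
  refine le_trans (le_of_eq ?_) (norm_le_pi_norm _ T)
  have h1 : (1 : ℂ) / (k : ℂ) = (((k : ℝ)⁻¹ : ℝ) : ℂ) := by push_cast; rw [one_div]
  congr 1
  simp only [Pi.smul_apply, Pi.sub_apply, Finset.sum_apply, smul_sub, neg_sub]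
  rw [← Nat.cast_smul_eq_nsmul ℝ, smul_smul, inv_mul_cancel₀ hk', one_smul, h1]
  rfl

lemma norm_id_coordOperators_le (n r : ℕ) :
    ‖coordId n r‖ ≤ 1 :=
  (pi_norm_le_iff_of_nonneg zero_le_one).2 fun _ => ContinuousLinearMap.norm_id_le

/-- AM-GM, used as a bound affine in `a` so that an expected square root is controlled by an
expectation. -/
lemma sqrt_le_avg {a t : ℝ} (ha : 0 ≤ a) (ht : 0 < t) : √a ≤ (a / t + t) / 2 := by
  have h := Real.sq_sqrt ha
  have h2 : a / t + t - 2 * √a = (√a - t) ^ 2 / t := by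
    field_simp
    nlinarith
  have h3 : 0 ≤ (√a - t) ^ 2 / t := by positivity
  linarith

/-- The self-bounding estimate for sampling with replacement. -/
lemma expect_norm_sum_coordTensor_sub_id_le {n r k : ℕ} (hr : 0 < r) (hrn : r ≤ n) (hk : 1 ≤ k)
    (x : Fin n → EuclideanSpace ℂ (Fin n)) {K ε : ℝ} (hK : 0 < K) (hx : ∀ i j, ‖x i j‖ ≤ K)
    (hid : ContinuousLinearMap.id ℂ (EuclideanSpace ℂ (Fin n)) =
      ((1 : ℂ) / (n : ℂ)) • ∑ i, tensorSelf (x i)) (hε : 0 < ε) (hε1 : ε ≤ 1)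
    (hβ : 4 * (14 * Nat.clog 2 r + 12) * ((16 * K * √r * √(2 * Real.log (4 * k))) *
      √(Real.log (4 * n))) ≤ ε / 2 * √k) :
    (k : ℝ)⁻¹ * 𝔼 g : Fin k → Fin n, ‖∑ i, (coordTensor r (x (g i)) -
      coordId n r)‖ ≤ ε := by
  set J := coordId n r with hJ
  have : NeZero n := ⟨by omega⟩
  have : NeZero k := ⟨by omega⟩
  have hk0 : (0 : ℝ) < k := by exact_mod_cast hk
  set A := 𝔼 g : Fin k → Fin n, ‖∑ i, (coordTensor r (x (g i)) - J)‖ with hA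
  set W := (16 * K * √r * √(2 * Real.log (4 * k))) * √(Real.log (4 * n)) with hW
  have hW0 : 0 ≤ W := by positivity
  have h1 : A ≤ 2 * 𝔼 g : Fin k → Fin n, 𝔼 e : Fin k → Bool,
      ‖∑ i, boolSign (e i) • coordTensor r (x (g i))‖ :=
    expect_norm_sum_sub_mean_le (fun j => coordTensor r (x j)) J (by
      rw [Fintype.card_fin]; exact sum_coordTensor_eq_smul_id x hid)
  have h2 : ∀ g : Fin k → Fin n, 𝔼 e : Fin k → Bool,
      ‖∑ i, boolSign (e i) • coordTensor r (x (g i))‖ ≤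
      2 * (14 * Nat.clog 2 r + 12) * W * √‖∑ i, coordTensor r (x (g i))‖ := by
    intro g
    have := expect_norm_rademacher_coordTensor_le hr hrn (fun i => x (g i)) hK
      fun i j => hx (g i) j
    rw [Fintype.card_fin] at this
    refine this.trans (le_of_eq ?_)
    rw [hW]; ring
  have hsk : 0 < √(k : ℝ) := Real.sqrt_pos.2 hk0
  have hsk2 : √(k : ℝ) * √k = k := Real.mul_self_sqrt hk0.le
  have h3 : ∀ g : Fin k → Fin n, √‖∑ i, coordTensor r (x (g i))‖ ≤
      (‖∑ i, (coordTensor r (x (g i)) - J)‖ + k) / (2 * √k) + √k / 2 := by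
    intro g
    have h4 : ‖∑ i, coordTensor r (x (g i))‖ ≤ ‖∑ i, (coordTensor r (x (g i)) - J)‖ + k := by
      have h5 : ∑ i, coordTensor r (x (g i)) =
          ∑ i, (coordTensor r (x (g i)) - J) + (k : ℝ) • J := by
        have h6 : (k : ℝ) • J = k • J := Nat.cast_smul_eq_nsmul ℝ k J
        rw [Finset.sum_sub_distrib, Finset.sum_const, Finset.card_univ, Fintype.card_fin, h6,
          sub_add_cancel]
      rw [h5]
      refine (norm_add_le _ _).trans (add_le_add le_rfl ?_)
      rw [norm_smul, Real.norm_natCast]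
      exact mul_le_of_le_one_right hk0.le (norm_id_coordOperators_le n r)
    calc _ ≤ (‖∑ i, coordTensor r (x (g i))‖ / √k + √k) / 2 := sqrt_le_avg (norm_nonneg _) hsk
      _ ≤ ((‖∑ i, (coordTensor r (x (g i)) - J)‖ + k) / √k + √k) / 2 := by gcongr
      _ = _ := by field_simp
  have h4 : A ≤ ε / 2 * √k * ((A + k) / (2 * √k) + √k / 2) := by
    calc A ≤ 2 * 𝔼 g : Fin k → Fin n, 2 * (14 * Nat.clog 2 r + 12) * W *
          ((‖∑ i, (coordTensor r (x (g i)) - J)‖ + k) / (2 * √k) + √k / 2) := by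
          refine h1.trans (mul_le_mul_of_nonneg_left ?_ zero_le_two)
          refine Finset.expect_le_expect fun g _ => (h2 g).trans ?_
          exact mul_le_mul_of_nonneg_left (h3 g) (by positivity)
      _ = 4 * (14 * Nat.clog 2 r + 12) * W * ((A + k) / (2 * √k) + √k / 2) := by
          rw [← Finset.mul_expect, Finset.expect_add_distrib, ← Finset.expect_div,
            Finset.expect_add_distrib, Fintype.expect_const, Fintype.expect_const]
          ring
      _ ≤ _ := by
          refine mul_le_mul_of_nonneg_right hβ ?_
          have : 0 ≤ A := Finset.expect_nonneg fun g _ => norm_nonneg _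
          positivity
  have hA0 : 0 ≤ A := Finset.expect_nonneg fun g _ => norm_nonneg _
  have h5 : ε / 2 * √k * ((A + k) / (2 * √k) + √k / 2) = ε / 4 * (A + 2 * k) := by
    have : ε / 2 * √k * ((A + k) / (2 * √k) + √k / 2) =
        ε / 4 * (A + k) + ε / 4 * (√k * √k) := by field_simp; norm_num
    rw [this, hsk2]; ring
  rw [h5] at h4
  rw [inv_mul_le_iff₀ hk0]
  -- From A ≤ (ε/4)(A + 2k) and ε ≤ 1, one gets 3A ≤ 2εk.
  nlinarith [mul_le_mul_of_nonneg_right hε1 hA0]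

lemma expectRandomSubset_le {n k : ℕ} {f : Finset (Fin n) → ℝ} {B : ℝ} (hk : k ≤ n)
    (h : ∀ Ω : Finset (Fin n), Ω.card = k → f Ω ≤ B) : expectRandomSubset n k f ≤ B := by
  have hne : (Finset.powersetCard k (Finset.univ : Finset (Fin n))).Nonempty :=
    Finset.powersetCard_nonempty.2 (by simpa using hk)
  exact Finset.expect_le hne fun Ω hΩ => h Ω (Finset.mem_powersetCard_univ.1 hΩ)

lemma expectRandomSubset_uniformDeviation_le {n r k : ℕ} (hk : 1 ≤ k) (hkn : k ≤ n)
    (x : Fin n → EuclideanSpace ℂ (Fin n)) :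
    expectRandomSubset n k (fun Ω => uniformDeviation x r k Ω) ≤
      (k : ℝ)⁻¹ * 𝔼 g : Fin k → Fin n, ‖∑ i, (coordTensor r (x (g i)) -
        coordId n r)‖ := by
  have : NeZero k := ⟨by omega⟩
  calc _ ≤ 𝔼 Ω ∈ Finset.powersetCard k (Finset.univ : Finset (Fin n)), (k : ℝ)⁻¹ * ‖∑ i ∈ Ω,
        (coordTensor r (x i) - coordId n r)‖ :=
        Finset.expect_le_expect fun Ω hΩ =>
          uniformDeviation_le hk x (Finset.mem_powersetCard_univ.1 hΩ)
    _ ≤ _ := by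
        rw [← Finset.mul_expect]
        gcongr
        exact expect_powersetCard_norm_sum_le (by simpa using hkn) _

theorem theorem3p3 (K : ℝ) :
    ∃ C : ℝ, 0 < C ∧
      ∀ (n r k : ℕ) (ε : ℝ) (x : Fin n → EuclideanSpace ℂ (Fin n)),
        2 ≤ r → 1 ≤ k → k ≤ n → 0 < ε → ε ≤ 1 →
        (∀ i j, ‖x i j‖ ≤ K) →
        ContinuousLinearMap.id ℂ (EuclideanSpace ℂ (Fin n)) =
          ((1 : ℂ) / (n : ℂ)) • ∑ i, tensorSelf (x i) →
        C * ((r : ℝ) * Real.log n / ε ^ 2) * Real.log ((r : ℝ) * Real.log n / ε ^ 2) *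
          Real.log r ^ 2 ≤ (k : ℝ) →
        expectRandomSubset n k (fun Ω => uniformDeviation x r k Ω) ≤ ε := by
  set κ := max K 1 with hκ
  have hκ1 : 1 ≤ κ := le_max_right _ _
  -- Chosen so that Q/4 exceeds 4² · 60² · 16² · 2 · 3 · 3 · κ² = 265420800 κ², the constant arising
  -- when the condition of the self-bounding estimate is squared.
  set Q : ℝ := 1100000000 * κ ^ 2 with hQ
  have hQ1 : 1 ≤ Q := by rw [hQ]; nlinarith
  refine ⟨8 * Q + 10 * (18 * Q) ^ 2, by positivity, ?_⟩
  intro n r k ε x hr hk hkn hε hε1 hx hid hC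
  -- For n = 1 the size condition is empty, but the sample is everything and the deviation vanishes.
  rcases (by omega : n = 1 ∨ 2 ≤ n) with rfl | hn
  · obtain rfl : k = 1 := by omega
    refine expectRandomSubset_le hkn fun Ω hΩ => ?_
    refine (uniformDeviation_le hk x hΩ).trans ?_
    have hu : Ω = Finset.univ := Finset.eq_univ_of_card Ω (by simpa using hΩ)
    have h0 := sum_coordTensor_eq_smul_id (r := r) x hid
    have h1 : ((1 : ℕ) : ℝ) • coordId 1 r = coordId 1 r := by
      rw [Nat.cast_one]; exact one_smul ℝ (coordId 1 r)
    have h2 : ∑ i, (coordTensor r (x i) - coordId 1 r) = 0 := by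
      rw [Finset.sum_sub_distrib, ← h0, h1, Finset.sum_const, Finset.card_univ, Fintype.card_fin,
        one_nsmul, sub_self]
    rw [hu, h2, norm_zero, mul_zero]
    exact hε.le
  have hr' : (2 : ℝ) ≤ r := by exact_mod_cast hr
  have hn' : (2 : ℝ) ≤ n := by exact_mod_cast hn
  have hl2 := Real.log_two_gt_d9
  have hln : Real.log 2 ≤ Real.log n := Real.log_le_log (by norm_num) hn'
  have hlr : Real.log 2 ≤ Real.log r := Real.log_le_log (by norm_num) hr'
  set a := (r : ℝ) * Real.log n / ε ^ 2 with ha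
  have hε2 : ε ^ 2 ≤ 1 := pow_le_one₀ hε.le hε1
  have har : 69 / 100 * (r : ℝ) ≤ a := by
    rw [ha, le_div_iff₀ (by positivity)]
    nlinarith
  have ha1 : 138 / 100 ≤ a := by linarith
  have hla : 27 / 100 ≤ Real.log a := by
    have h1 := Real.one_sub_inv_le_log_of_pos (show 0 < a by linarith)
    have h2 : a⁻¹ ≤ (138 / 100)⁻¹ := inv_anti₀ (by norm_num) ha1
    norm_num at h2
    linarith
  have hρ2 : 47 / 100 ≤ Real.log r ^ 2 := by nlinarith
  have hprod : a * (12 / 100) ≤ a * Real.log a * Real.log r ^ 2 := by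
    rw [mul_assoc]
    gcongr
    nlinarith
  -- The size condition forces r ≤ k ≤ n, which the chaining bound requires.
  have hrk : r ≤ k := by
    have h1 : (r : ℝ) ≤ k := by
      refine le_trans ?_ hC
      have h2 : (20 : ℝ) * (a * (12 / 100)) ≤
          (8 * Q + 10 * (18 * Q) ^ 2) * (a * Real.log a * Real.log r ^ 2) := by
        gcongr
        nlinarith
      linarith
    exact_mod_cast h1
  have hrn : r ≤ n := hrk.trans hkn
  have hlrr : Real.log r ≤ 3 / 2 * a := by
    have := Real.log_le_sub_one_of_pos (show (0 : ℝ) < r by linarith)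
    linarith
  have hmain : Q * a * Real.log r ^ 2 * Real.log k ≤ k :=
    mul_log_le_of_mul_log_le hQ1 (by linarith) (by linarith) hlrr (by linarith) hC
  refine (expectRandomSubset_uniformDeviation_le hk hkn x).trans
    (expect_norm_sum_coordTensor_sub_id_le (by omega) hrn hk x (K := κ) (by linarith)
      (fun i j => (hx i j).trans (le_max_left _ _)) hid hε hε1 ?_)
  have hk2 : 2 ≤ k := hr.trans hrk
  have hlk : 0 < Real.log k := Real.log_pos (by exact_mod_cast hk2)
  have hlogn : 0 < Real.log n := by linarith
  have hlogr : 0 < Real.log r := by linarith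
  rw [← sq_le_sq₀ (by positivity) (by positivity)]
  simp only [mul_pow]
  have h4k : 0 ≤ Real.log (4 * k) := Real.log_nonneg (by
    have : (2 : ℝ) ≤ k := by exact_mod_cast hk2
    linarith)
  have h4n : 0 ≤ Real.log (4 * n) := Real.log_nonneg (by linarith)
  rw [Real.sq_sqrt (by positivity), Real.sq_sqrt (by positivity), Real.sq_sqrt h4n,
    Real.sq_sqrt (by positivity)]
  calc _ ≤ 4 ^ 2 * (60 * Real.log r) ^ 2 * (16 ^ 2 * κ ^ 2 * r * (2 * (3 * Real.log k)) *
        (3 * Real.log n)) := by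
        gcongr
        · exact clog_two_le_mul_log hr
        · exact log_four_mul_le hk2
        · exact log_four_mul_le hn
    _ ≤ ε ^ 2 / 4 * (Q * a * Real.log r ^ 2 * Real.log k) := by
        have : ε ^ 2 / 4 * (Q * a * Real.log r ^ 2 * Real.log k) =
            275000000 * (κ ^ 2 * r * Real.log n * Real.log r ^ 2 * Real.log k) := by
          rw [hQ, ha]; field_simp; norm_num
        rw [this]
        have hpos : 0 ≤ κ ^ 2 * r * Real.log n * Real.log r ^ 2 * Real.log k := by positivity
        linarith
    _ ≤ ε ^ 2 / 4 * k := by gcongr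
    _ = _ := by ring
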